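/- A hypergraph $H=(V,E)$ consists of a finite vertex set $V$ and a set $E$ of subsets of $V$ (the edges). Let $R(H)=\{|F| : F\in E\}$; $H$ is called an $R$-graph if $R(H)=R$. For $r\ge 1$ let $H^r$ be the hypergraph on $V$ whose edges are the edges of $H$ with exactly $r$ vertices, and let $e(G)$ denote the number of edges of a hypergraph $G$. Let $K_n^{R}$ be the hypergraph on $\{1,\dots,n\}$ whose edges are all subsets of $\{1,\dots,n\}$ with cardinality in $R$. A complete $R$-subgraph of order $k$ of $H$ is a $k$-element set $S\subseteq V$ such that every subset of $S$ with cardinality in $R$ is an edge of $H$. The Lagrangian of $H$ is $$\lambda'(H)=\max\Big\{\sum_{j\in R(H)} j!\sum_{\{i_1,\dots,i_j\}\in E(H^j)}x_{i_1}\cdots x_{i_j}\ :\ x_v\ge 0\ (v\in V),\ \sum_{v\in V}x_v=1\Big\}.$$ **Theorem 1.6.** Let $t\ge 5$ and $s\ge t$ be integers and let $H$ be a $\{1,3\}$-graph. Suppose that the largest order of a complete $\{1,3\}$-subgraph of $H$ is $t$, that the largest order of a complete $\{3\}$-subgraph of $H^3$ is $s$, and that $$\binom{s}{3}\le e(H^3)\le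 \binom{s}{3}+\binom{t-1}{2}.$$ Then $$\lambda'(H)=\lambda'\big(K_t^{\{1,3\}}\big)=1+\frac{(t-1)(t-2)}{t^2}.$$ -/

import Mathlib

open scoped Nat

namespace Hypergraph

/-! Hypergraphs are Mathlib's `Hypergraph α`: a set of vertices and a set of edges, each edge being
a set of vertices. The notions below are meant for hypergraphs whose vertex set is finite. -/

/-- The set `R(H) = {|F| : F ∈ E(H)}` of edge types of `H`. -/
def edgeTypes {α : Type*} (H : Hypergraph α) : Set ℕ :=
  {r | ∃ e ∈ H.edgeSet, e.ncard = r}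

/-- The level hypergraph `H^r`: same vertices, only the edges with exactly `r` vertices. -/
def level {α : Type*} (H : Hypergraph α) (r : ℕ) : Hypergraph α where
  vertexSet := H.vertexSet
  edgeSet := {e | e ∈ H.edgeSet ∧ e.ncard = r}
  subset_vertexSet_of_mem_edgeSet' := fun _ he => H.subset_vertexSet_of_mem_edgeSet' he.1

/-- The number of edges `e(H)`. -/
noncomputable def numEdges {α : Type*} (H : Hypergraph α) : ℕ := H.edgeSet.ncard

/-- `G` is a subhypergraph of `H`. -/
def IsSubhypergraph {α : Type*} (G H : Hypergraph α) : Prop :=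
  G.vertexSet ⊆ H.vertexSet ∧ G.edgeSet ⊆ H.edgeSet

/-- The complete hypergraph with edge types `R` on the vertex set `S`: its edges are all the
subsets of `S` whose cardinality is in `R`. -/
def completeOfTypes {α : Type*} (S : Set α) (R : Set ℕ) : Hypergraph α where
  vertexSet := S
  edgeSet := {e | e ⊆ S ∧ e.ncard ∈ R}
  subset_vertexSet_of_mem_edgeSet' := fun _ he => he.1

/-- The complete hypergraph `K_n^R` on the vertex set `[n] = {1, …, n}`. -/
def completeK (n : ℕ) (R : Set ℕ) : Hypergraph ℕ := completeOfTypes (Set.Icc 1 n) R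

/-- The orders of the complete `R`-subgraphs of `H`. -/
def completeSubgraphOrders {α : Type*} (H : Hypergraph α) (R : Set ℕ) : Set ℕ :=
  {k | ∃ S : Set α, S.ncard = k ∧ (completeOfTypes S R).IsSubhypergraph H}

/-- The order of a largest complete `R`-subgraph of `H` is `k`. -/
def MaxCompleteOrder {α : Type*} (H : Hypergraph α) (R : Set ℕ) (k : ℕ) : Prop :=
  IsGreatest (H.completeSubgraphOrders R) k

/-- The legal weightings of `H`: nonnegative weights on the vertices of `H` with sum `1`. A
weighting is extended by `0` to the elements of `α` that are not vertices of `H`. -/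
def legalWeightings {α : Type*} (H : Hypergraph α) : Set (α → ℝ) :=
  {x | (∀ v, 0 ≤ x v) ∧ (∀ v, v ∉ H.vertexSet → x v = 0) ∧ ∑ᶠ v ∈ H.vertexSet, x v = 1}

/-- The polynomial
`λ'(H, x) = ∑_{j ∈ R(H)} j! ∑_{i₁ ⋯ i_j ∈ H^j} x_{i₁} ⋯ x_{i_j}`. -/
noncomputable def lagrangianPoly {α : Type*} (H : Hypergraph α) (x : α → ℝ) : ℝ :=
  ∑ᶠ j ∈ H.edgeTypes, (j ! : ℝ) * ∑ᶠ e ∈ (H.level j).edgeSet, ∏ᶠ v ∈ e, x v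

/-- The Lagrangian `λ'(H)`, the maximum of `λ'(H, x)` over the legal weightings `x`. That the
supremum is attained is `isGreatest_lagrangian`. -/
noncomputable def lagrangian {α : Type*} (H : Hypergraph α) : ℝ :=
  sSup (H.lagrangianPoly '' H.legalWeightings)

theorem finite_edgeSet {α : Type*} (H : Hypergraph α) (hV : H.vertexSet.Finite) :
    H.edgeSet.Finite :=
  hV.finite_subsets.subset fun _ he => H.subset_vertexSet_of_mem_edgeSet' he

theorem continuous_lagrangianPoly {α : Type*} (H : Hypergraph α) (hV : H.vertexSet.Finite) :
    Continuous H.lagrangianPoly := by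
  have hE := H.finite_edgeSet hV
  have hR : H.edgeTypes.Finite := hE.image Set.ncard
  have hl : ∀ j, (H.level j).edgeSet.Finite := fun j => hE.subset fun _ he => he.1
  have hprod : ∀ e ∈ H.edgeSet, Continuous fun x : α → ℝ => ∏ᶠ v ∈ e, x v := by
    intro e he
    have hef : e.Finite := hV.subset (H.subset_vertexSet_of_mem_edgeSet' he)
    simp_rw [finprod_mem_eq_finite_toFinset_prod _ hef]
    fun_prop
  unfold lagrangianPoly
  simp_rw [finsum_mem_eq_finite_toFinset_sum _ hR, finsum_mem_eq_finite_toFinset_sum _ (hl _)]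
  refine continuous_finsetSum _ fun j _ => continuous_const.mul ?_
  refine continuous_finsetSum _ fun e he => hprod e ?_
  exact ((hl j).mem_toFinset.1 he).1

theorem isCompact_legalWeightings {α : Type*} (H : Hypergraph α) (hV : H.vertexSet.Finite) :
    IsCompact H.legalWeightings := by
  have hsum : ∀ x : α → ℝ, ∑ᶠ v ∈ H.vertexSet, x v = ∑ v ∈ hV.toFinset, x v := fun x =>
    finsum_mem_eq_finite_toFinset_sum _ hV
  have hbox : IsCompact (Set.univ.pi fun _ : α => Set.Icc (0 : ℝ) 1) :=
    isCompact_univ_pi fun _ => isCompact_Icc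
  refine hbox.of_isClosed_subset ?_ ?_
  · simp only [legalWeightings, hsum, Set.ofPred_and, Set.ofPred_forall]
    refine (isClosed_iInter fun v => isClosed_le continuous_const (continuous_apply v)).inter
      ((isClosed_iInter fun v => isClosed_iInter fun _ =>
        isClosed_eq (continuous_apply v) continuous_const).inter
      (isClosed_eq (by fun_prop) continuous_const))
  · rintro x ⟨h0, hz, h1⟩ v -
    refine ⟨h0 v, ?_⟩
    by_cases hv : v ∈ H.vertexSet
    · rw [hsum] at h1
      rw [← h1]
      exact Finset.single_le_sum (fun w _ => h0 w) (hV.mem_toFinset.2 hv)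
    · rw [hz v hv]
      exact zero_le_one

theorem nonempty_legalWeightings {α : Type*} (H : Hypergraph α) (hne : H.vertexSet.Nonempty) :
    H.legalWeightings.Nonempty := by
  classical
  obtain ⟨a, ha⟩ := hne
  refine ⟨Pi.single a 1, fun v => ?_, fun v hv => ?_, ?_⟩
  · by_cases h : v = a
    · subst h; simp
    · simp [h]
  · have h : v ≠ a := by
      rintro rfl
      exact hv ha
    simp [h]
  · rw [finsum_eq_single _ a (fun v h => by simp [h])]
    simp [ha]

/-- For a nonempty finite vertex set the Lagrangian is a maximum. -/
theorem isGreatest_lagrangian {α : Type*} (H : Hypergraph α) (hV : H.vertexSet.Finite)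
    (hne : H.vertexSet.Nonempty) :
    IsGreatest (H.lagrangianPoly '' H.legalWeightings) H.lagrangian :=
  ((H.isCompact_legalWeightings hV).image (H.continuous_lagrangianPoly hV)).isGreatest_sSup
    ((H.nonempty_legalWeightings hne).image _)

end Hypergraph

/-!
The polynomial of a `{1, 3}`-graph is the weight of the vertices that are edges of their own plus
the cubic form `6 ∑ x_i x_j x_k` over the edges of size three. The uniform weighting on a complete
`{1, 3}`-subgraph of order `t` gives the lower bound, so what matters is the upper bound
`1 + (t - 1)(t - 2) / t²`.

Let `S` be a clique of order `s` of `H^3`. At most `t` of its vertices are edges of their own; let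
`P ⊆ S` contain them, with `|P| = t`. The linear part is at most `1 - x(S \ P)`, so it suffices that
the cubic form is at most `(t - 1)(t - 2) / t² + x(S \ P)`. Merging a vertex of `S \ P` with a
lightest vertex of `P`, whose weight is at most `1 / 5`, reduces this to `x(S \ P) = 0`
(`cubicForm_le_add_sum_sdiff`). Then only a clique of order `t` and at most `(t - 1).choose 2` edges
besides it count, and the bound is the theorem of Peng and Zhao that such a `3`-graph has the
Lagrangian of the clique (`cubicForm_le_of_clique`).

For the latter, take an extremal family together with an optimal weighting `x`. After exchanges the
clique `P` carries the `t` largest weights and the family is shifted. Let `p` be the lightest vertex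
of `P`, let `v` be the lightest vertex of positive weight outside `P`, and let `k` be the number of
such vertices, so that their total weight `Y` is at most `(k - 1) x_p + x_v`. Let `μ` be the number
of pairs of `P \ {p}` missing from the link of `v`, and `c` the number of vertices of `P` that form
an edge with `p` and `v`. Comparing the links of `p` and `v` gives `μ x_p² ≤ (x_p - x_v) W`, where `W`
is the weight of those `c` vertices (`missing_pairs_le`). Comparing the links of two vertices of `P`
shows that their weights differ by at most `Y` (`sub_le_outer_weight`), so `W ≤ c (k x_p + x_v)`.
Counting edges gives `k c ≤ μ` (`count_edges`). Together, `μ x_p² ≤ μ (x_p² - x_v²)`, hence `μ = 0` and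
`c = 0`, and the count now yields `k = 1`. So the weight of `v` can be moved to `p` without changing
the value, and Maclaurin's inequality on `P` finishes the proof (`cubicForm_le_of_shifted`).
-/

namespace Hypergraph

open Finset

/-! ### The cubic form of a family of triples -/

section Forms

variable {V : Type*} [DecidableEq V] {E : Finset (Finset V)}

/-- The indicator of `{i, j, k} ∈ E`, as a symmetric function of three vertices. When all members of
`E` have three elements it vanishes unless its arguments are distinct. -/
noncomputable def triInd (E : Finset (Finset V)) (i j k : V) : ℝ :=
  if ({i, j, k} : Finset V) ∈ E then 1 else 0

theorem triInd_nonneg (i j k : V) : 0 ≤ triInd E i j k := by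
  unfold triInd; split_ifs <;> norm_num

theorem triInd_le_one (i j k : V) : triInd E i j k ≤ 1 := by
  unfold triInd; split_ifs <;> norm_num

theorem triInd_swap_left (i j k : V) : triInd E i j k = triInd E j i k := by
  unfold triInd; rw [Finset.insert_comm]

theorem triInd_swap_right (i j k : V) : triInd E i j k = triInd E i k j := by
  unfold triInd; rw [Finset.pair_comm]

theorem triInd_of_mem {i j k : V} (h : ({i, j, k} : Finset V) ∈ E) : triInd E i j k = 1 :=
  if_pos h

theorem triInd_of_notMem {i j k : V} (h : ({i, j, k} : Finset V) ∉ E) : triInd E i j k = 0 :=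
  if_neg h

theorem distinct_of_triple_mem (hE : ∀ e ∈ E, #e = 3) {i j k : V}
    (h : ({i, j, k} : Finset V) ∈ E) : i ≠ j ∧ i ≠ k ∧ j ≠ k := by
  have h3 := hE _ h
  refine ⟨?_, ?_, ?_⟩
  · rintro rfl
    have := Finset.card_le_two (a := i) (b := k)
    rw [Finset.insert_idem] at h3
    omega
  · rintro rfl
    have := Finset.card_le_two (a := i) (b := j)
    rw [Finset.insert_comm, Finset.pair_eq_singleton, Finset.pair_comm] at h3
    omega
  · rintro rfl
    have := Finset.card_le_two (a := i) (b := j)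
    rw [Finset.pair_eq_singleton] at h3
    omega

theorem triInd_self_left (hE : ∀ e ∈ E, #e = 3) (i k : V) : triInd E i i k = 0 :=
  triInd_of_notMem fun h => (distinct_of_triple_mem hE h).1 rfl

theorem triInd_self_right (hE : ∀ e ∈ E, #e = 3) (i k : V) : triInd E i k k = 0 :=
  triInd_of_notMem fun h => (distinct_of_triple_mem hE h).2.2 rfl

theorem triInd_self_outer (hE : ∀ e ∈ E, #e = 3) (i k : V) : triInd E i k i = 0 :=
  triInd_of_notMem fun h => (distinct_of_triple_mem hE h).2.1 rfl

/-- The characteristic function of a finite set, as a weighting. -/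
def charW (P : Finset V) (i : V) : ℝ := if i ∈ P then 1 else 0

theorem charW_nonneg (P : Finset V) (i : V) : 0 ≤ charW P i := by
  unfold charW; split_ifs <;> norm_num

variable [Fintype V]

/-- The total weight of the vertices that form an edge of `E` together with `i` and `j`. -/
noncomputable def codegW (E : Finset (Finset V)) (x : V → ℝ) (i j : V) : ℝ :=
  ∑ k, triInd E i j k * x k

/-- The weight of the link of `i`, over ordered pairs: a third of the partial derivative of
`cubicForm E` at `x` in direction `i`. -/
noncomputable def linkW (E : Finset (Finset V)) (x : V → ℝ) (i : V) : ℝ :=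
  ∑ j, codegW E x i j * x j

/-- The weight of `E` over ordered triples of vertices. For a `3`-uniform family it is six times the
sum of the products of weights over the edges (`cubicForm_eq_six_mul_sum`). -/
noncomputable def cubicForm (E : Finset (Finset V)) (x : V → ℝ) : ℝ :=
  ∑ i, linkW E x i * x i

theorem codegW_comm (x : V → ℝ) (i j : V) : codegW E x i j = codegW E x j i := by
  unfold codegW
  exact Finset.sum_congr rfl fun k _ => by rw [triInd_swap_left]

theorem codegW_self (hE : ∀ e ∈ E, #e = 3) (x : V → ℝ) (i : V) : codegW E x i i = 0 := by
  unfold codegW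
  exact Finset.sum_eq_zero fun k _ => by rw [triInd_self_left hE, zero_mul]

theorem codegW_nonneg {x : V → ℝ} (hx : ∀ i, 0 ≤ x i) (i j : V) : 0 ≤ codegW E x i j :=
  Finset.sum_nonneg fun k _ => mul_nonneg (triInd_nonneg _ _ _) (hx k)

theorem linkW_nonneg {x : V → ℝ} (hx : ∀ i, 0 ≤ x i) (i : V) : 0 ≤ linkW E x i :=
  Finset.sum_nonneg fun k _ => mul_nonneg (codegW_nonneg hx _ _) (hx k)

theorem codegW_add_single (x : V → ℝ) (i j q : V) (θ : ℝ) :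
    codegW E (x + Pi.single q θ) i j = codegW E x i j + θ * triInd E i j q := by
  simp only [codegW, Pi.add_apply, mul_add, Finset.sum_add_distrib, Pi.single_apply, mul_ite,
    mul_zero, Finset.sum_ite_eq', Finset.mem_univ, if_true]
  ring

theorem sum_triInd_mul (x : V → ℝ) (i q : V) :
    ∑ j, triInd E i j q * x j = codegW E x i q :=
  Finset.sum_congr rfl fun j _ => by rw [triInd_swap_right]

theorem linkW_add_single (hE : ∀ e ∈ E, #e = 3) (x : V → ℝ) (i q : V) (θ : ℝ) :
    linkW E (x + Pi.single q θ) i = linkW E x i + 2 * θ * codegW E x i q := by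
  have h := sum_triInd_mul (E := E) x i q
  simp only [linkW, codegW_add_single, Pi.add_apply, mul_add, add_mul, Finset.sum_add_distrib,
    Pi.single_apply, mul_ite, mul_zero, Finset.sum_ite_eq', Finset.mem_univ, if_true,
    triInd_self_right hE, mul_assoc, ← Finset.mul_sum, h]
  ring

theorem cubicForm_add_single (hE : ∀ e ∈ E, #e = 3) (x : V → ℝ) (p : V) (θ : ℝ) :
    cubicForm E (x + Pi.single p θ) = cubicForm E x + 3 * θ * linkW E x p := by
  have h : ∑ i, codegW E x i p * x i = linkW E x p :=
    Finset.sum_congr rfl fun j _ => by rw [codegW_comm]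
  simp only [cubicForm, linkW_add_single hE, Pi.add_apply, mul_add, add_mul,
    Finset.sum_add_distrib, Pi.single_apply, mul_ite, mul_zero, Finset.sum_ite_eq',
    Finset.mem_univ, if_true, codegW_self hE, mul_assoc, ← Finset.mul_sum, h]
  ring

/-- The effect of moving the weight `θ` from `q` to `p`: the form is quadratic in `θ`, since no edge
contains a vertex twice. -/
theorem cubicForm_shift (hE : ∀ e ∈ E, #e = 3) (x : V → ℝ) (p q : V) (θ : ℝ) :
    cubicForm E (x + Pi.single p θ + Pi.single q (-θ)) =
      cubicForm E x + 3 * θ * (linkW E x p - linkW E x q) - 6 * θ ^ 2 * codegW E x p q := by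
  rw [cubicForm_add_single hE, cubicForm_add_single hE, linkW_add_single hE, codegW_comm x q p]
  ring

/-- The weighting `x` with the weights of `p` and `q` replaced by zero. -/
def eraseTwo (x : V → ℝ) (p q : V) (i : V) : ℝ := if i = p ∨ i = q then 0 else x i

/-- The difference of two links, split into the edges through both vertices and those through only
one of them. -/
theorem linkW_sub_linkW (hE : ∀ e ∈ E, #e = 3) (x : V → ℝ) {p q : V} (hpq : p ≠ q) :
    linkW E x p - linkW E x q = 2 * (x q - x p) * codegW E x p q +
      ∑ j, ∑ k, (triInd E p j k - triInd E q j k) * (eraseTwo x p q j * eraseTwo x p q k) := by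
  have hx : x = eraseTwo x p q + Pi.single p (x p) + Pi.single q (x q) := by
    funext i
    by_cases h1 : i = p
    · subst h1; simp [eraseTwo, hpq]
    · by_cases h2 : i = q
      · subst h2; simp [eraseTwo, h1]
      · simp [eraseTwo, h1, h2]
  set y := eraseTwo x p q
  have hc : codegW E x p q = codegW E y p q := by
    rw [hx, codegW_add_single, codegW_add_single, triInd_self_right hE, triInd_self_outer hE]
    ring
  have hp : linkW E x p = linkW E y p + 2 * x q * codegW E y p q := by
    conv_lhs => rw [hx]
    rw [linkW_add_single hE, linkW_add_single hE, codegW_add_single, codegW_self hE,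
      triInd_self_outer hE]
    ring
  have hq : linkW E x q = linkW E y q + 2 * x p * codegW E y p q := by
    conv_lhs => rw [hx]
    rw [linkW_add_single hE, linkW_add_single hE, codegW_self hE, codegW_comm y q p]
    ring
  have hs : ∑ j, ∑ k, (triInd E p j k - triInd E q j k) * (y j * y k) =
      linkW E y p - linkW E y q := by
    simp only [linkW, codegW, Finset.sum_mul, ← Finset.sum_sub_distrib]
    exact Finset.sum_congr rfl fun j _ => Finset.sum_congr rfl fun k _ => by ring
  rw [hs, hc, hp, hq]
  ring

theorem cubicForm_eq_sum (E : Finset (Finset V)) (x : V → ℝ) :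
    cubicForm E x = ∑ i, ∑ j, ∑ k, triInd E i j k * (x i * x j * x k) := by
  simp only [cubicForm, linkW, codegW, Finset.sum_mul]
  exact Finset.sum_congr rfl fun i _ => Finset.sum_congr rfl fun j _ =>
    Finset.sum_congr rfl fun k _ => by ring

/-- The sum over ordered triples of distinct elements, by inclusion and exclusion. -/
theorem sum_distinct_triples (x : V → ℝ) :
    ∑ i, ∑ j, ∑ k, (if i ≠ j ∧ i ≠ k ∧ j ≠ k then x i * x j * x k else 0) =
      (∑ i, x i) ^ 3 - 3 * (∑ i, x i) * ∑ i, x i ^ 2 + 2 * ∑ i, x i ^ 3 := by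
  have h : ∀ i j k : V, (if i ≠ j ∧ i ≠ k ∧ j ≠ k then x i * x j * x k else 0) =
      x i * x j * x k - (if j = i then x i * x i * x k else 0) -
        (if k = i then x i * x j * x i else 0) - (if k = j then x i * x j * x j else 0) +
        2 * (if j = i then if k = i then x i * x i * x i else 0 else 0) := by
    intro i j k
    by_cases h1 : i = j
    · subst h1
      by_cases h2 : i = k
      · subst h2; simp; ring
      · simp [h2, Ne.symm h2]
    · by_cases h2 : i = k
      · subst h2; simp [h1, Ne.symm h1]
      · by_cases h3 : j = k
        · subst h3; simp [h1, Ne.symm h1]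
        · simp [h1, h2, h3, Ne.symm h1, Ne.symm h2, Ne.symm h3]
  have e0 : ∑ i, ∑ j, ∑ k, 2 * (if j = i then if k = i then x i * x i * x i else 0 else 0) =
      2 * ∑ i, ∑ j, ∑ k, (if j = i then if k = i then x i * x i * x i else 0 else 0) := by
    simp only [← Finset.mul_sum]
  simp only [h, Finset.sum_add_distrib, Finset.sum_sub_distrib, e0,
    Finset.sum_ite_eq', Finset.mem_univ, if_true]
  have e1 : ∑ i, ∑ j, ∑ k, x i * x j * x k = (∑ i, x i) ^ 3 := by
    simp only [← Finset.mul_sum, ← Finset.sum_mul]; ring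
  have e2 : ∑ i, ∑ j, (if j = i then x i * x i * ∑ k, x k else 0) = (∑ i, x i ^ 2) * ∑ i, x i := by
    simp only [Finset.sum_ite_eq', Finset.mem_univ, if_true, ← Finset.sum_mul]
    simp only [pow_two]
  have e3 : ∑ i, ∑ j, x i * x j * x i = (∑ i, x i ^ 2) * ∑ i, x i := by
    rw [Finset.sum_mul_sum]
    exact Finset.sum_congr rfl fun i _ => Finset.sum_congr rfl fun j _ => by ring
  have e4 : ∑ i, ∑ j, x i * x j * x j = (∑ i, x i ^ 2) * ∑ i, x i := by
    rw [mul_comm, Finset.sum_mul_sum]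
    exact Finset.sum_congr rfl fun i _ => Finset.sum_congr rfl fun j _ => by ring
  have e5 : ∑ i, ∑ j, ∑ k, (if j = i then x i * x i * x k else 0) =
      (∑ i, x i ^ 2) * ∑ i, x i := by
    rw [← e2]
    refine Finset.sum_congr rfl fun i _ => Finset.sum_congr rfl fun j _ => ?_
    split_ifs
    · rw [Finset.mul_sum]
    · simp
  have e6 : ∑ i, ∑ j, ∑ k, (if j = i then if k = i then x i * x i * x i else 0 else 0) =
      ∑ i, x i ^ 3 := by
    refine Finset.sum_congr rfl fun i _ => ?_
    rw [Finset.sum_eq_single i (fun b _ hb => by simp [hb]) (by simp)]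
    simp
    ring
  rw [e1, e3, e4, e5, e6]
  ring

theorem triInd_le_distinct (hE : ∀ e ∈ E, #e = 3) {x : V → ℝ} (hx : ∀ i, 0 ≤ x i) (i j k : V) :
    triInd E i j k * (x i * x j * x k) ≤
      if i ≠ j ∧ i ≠ k ∧ j ≠ k then x i * x j * x k else 0 := by
  have h0 : 0 ≤ x i * x j * x k := mul_nonneg (mul_nonneg (hx i) (hx j)) (hx k)
  split_ifs with h
  · exact mul_le_of_le_one_left h0 (triInd_le_one _ _ _)
  · rw [triInd_of_notMem fun hm => h (distinct_of_triple_mem hE hm), zero_mul]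

/-- The Lagrangian of a `3`-uniform family on `t` vertices is at most that of the complete one. -/
theorem cubicForm_le_of_support (hE : ∀ e ∈ E, #e = 3) {x : V → ℝ} (hx : ∀ i, 0 ≤ x i)
    (hx1 : ∑ i, x i = 1) {P : Finset V} {t : ℕ} (ht : 4 ≤ t) (hP : #P = t)
    (hsupp : ∀ i, i ∉ P → x i = 0) :
    cubicForm E x ≤ ((t : ℝ) - 1) * (t - 2) / t ^ 2 := by
  have h1 : cubicForm E x ≤ 1 - (3 * ∑ i, x i ^ 2 - 2 * ∑ i, x i ^ 3) := by
    have := sum_distinct_triples x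
    rw [hx1] at this
    rw [cubicForm_eq_sum]
    calc _ ≤ ∑ i, ∑ j, ∑ k, (if i ≠ j ∧ i ≠ k ∧ j ≠ k then x i * x j * x k else 0) :=
          Finset.sum_le_sum fun i _ => Finset.sum_le_sum fun j _ => Finset.sum_le_sum fun k _ =>
            triInd_le_distinct hE hx i j k
      _ = _ := by rw [this]; ring
  have ht4 : (4 : ℝ) ≤ t := by exact_mod_cast ht
  have ht0 : (t : ℝ) ≠ 0 := by linarith
  have hle1 : ∀ i, x i ≤ 1 := fun i => by
    rw [← hx1]; exact Finset.single_le_sum (fun j _ => hx j) (Finset.mem_univ i)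
  have hres : ∀ f : ℝ → ℝ, f 0 = 0 → ∑ i, f (x i) = ∑ i ∈ P, f (x i) := fun f h0 =>
    (Finset.sum_subset (Finset.subset_univ P) fun i _ hi => by rw [hsupp i hi, h0]).symm
  have h2 : 3 / (t : ℝ) - 2 / t ^ 2 ≤ 3 * ∑ i, x i ^ 2 - 2 * ∑ i, x i ^ 3 := by
    have hs1 : ∑ i ∈ P, x i = 1 := by rw [← hx1]; exact (hres (fun y => y) rfl).symm
    rw [Finset.mul_sum, Finset.mul_sum, ← Finset.sum_sub_distrib,
      hres (fun y => 3 * y ^ 2 - 2 * y ^ 3) (by norm_num)]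
    -- the tangent line of `3 y ^ 2 - 2 y ^ 3` at `1 / t` lies below it on `[0, 1]`
    have htan : ∀ i ∈ P, 3 / (t : ℝ) ^ 2 - 2 / t ^ 3 + (6 / t - 6 / t ^ 2) * (x i - 1 / t) ≤
        3 * x i ^ 2 - 2 * x i ^ 3 := by
      intro i _
      have key : 3 * x i ^ 2 - 2 * x i ^ 3 -
          (3 / (t : ℝ) ^ 2 - 2 / t ^ 3 + (6 / t - 6 / t ^ 2) * (x i - 1 / t)) =
          (x i - 1 / t) ^ 2 * (3 - 4 / t - 2 * x i) := by
        field_simp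
        ring
      have h4 : 4 / (t : ℝ) ≤ 1 := by rw [div_le_one (by linarith)]; exact ht4
      have : 0 ≤ (x i - 1 / t) ^ 2 * (3 - 4 / (t : ℝ) - 2 * x i) :=
        mul_nonneg (sq_nonneg _) (by linarith [hle1 i])
      linarith
    refine le_trans (le_of_eq ?_) (Finset.sum_le_sum htan)
    rw [Finset.sum_add_distrib, ← Finset.mul_sum, Finset.sum_sub_distrib,
      Finset.sum_sub_distrib, hs1]
    simp only [Finset.sum_const, hP, nsmul_eq_mul]
    field_simp
    ring
  have h3 : ((t : ℝ) - 1) * (t - 2) / t ^ 2 = 1 - (3 / (t : ℝ) - 2 / t ^ 2) := by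
    field_simp
    ring
  rw [h3]
  linarith

theorem cubicForm_eq_six_mul_sum (hE : ∀ e ∈ E, #e = 3) (x : V → ℝ) :
    cubicForm E x = 6 * ∑ e ∈ E, ∏ i ∈ e, x i := by
  have h1 : ∀ i j k : V, triInd E i j k * (x i * x j * x k) =
      ∑ e ∈ E, if ({i, j, k} : Finset V) = e then x i * x j * x k else 0 := by
    intro i j k
    rw [Finset.sum_ite_eq]
    simp [triInd]
  rw [cubicForm_eq_sum]
  simp only [h1]
  have h2 : ∑ i, ∑ j, ∑ k, ∑ e ∈ E, (if ({i, j, k} : Finset V) = e then x i * x j * x k else 0) =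
      ∑ e ∈ E, ∑ i, ∑ j, ∑ k, (if ({i, j, k} : Finset V) = e then x i * x j * x k else 0) := by
    simp only [Finset.sum_comm (t := E)]
  rw [h2, Finset.mul_sum]
  refine Finset.sum_congr rfl fun e he => ?_
  obtain ⟨a, b, c, hab, hac, hbc, rfl⟩ := Finset.card_eq_three.1 (hE e he)
  have h3 : ∀ i j k : V, (({i, j, k} : Finset V) = {a, b, c}) ↔
      (i = a ∧ j = b ∧ k = c) ∨ (i = a ∧ j = c ∧ k = b) ∨ (i = b ∧ j = a ∧ k = c) ∨
      (i = b ∧ j = c ∧ k = a) ∨ (i = c ∧ j = a ∧ k = b) ∨ (i = c ∧ j = b ∧ k = a) := by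
    intro i j k
    constructor
    · intro h
      have ha : a ∈ ({i, j, k} : Finset V) := by rw [h]; simp
      have hb : b ∈ ({i, j, k} : Finset V) := by rw [h]; simp
      have hc : c ∈ ({i, j, k} : Finset V) := by rw [h]; simp
      simp only [Finset.mem_insert, Finset.mem_singleton] at ha hb hc
      grind
    · rintro (⟨rfl, rfl, rfl⟩ | ⟨rfl, rfl, rfl⟩ | ⟨rfl, rfl, rfl⟩ | ⟨rfl, rfl, rfl⟩ |
        ⟨rfl, rfl, rfl⟩ | ⟨rfl, rfl, rfl⟩) <;> ext <;> simp <;> tauto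
  have h4 : ∀ i j k : V, (if ({i, j, k} : Finset V) = {a, b, c} then x i * x j * x k else 0) =
      x a * x b * x c *
      ((if i = a then if j = b then if k = c then 1 else 0 else 0 else 0) +
      (if i = a then if j = c then if k = b then 1 else 0 else 0 else 0) +
      (if i = b then if j = a then if k = c then 1 else 0 else 0 else 0) +
      (if i = b then if j = c then if k = a then 1 else 0 else 0 else 0) +
      (if i = c then if j = a then if k = b then 1 else 0 else 0 else 0) +
      (if i = c then if j = b then if k = a then 1 else 0 else 0 else 0)) := by
    intro i j k
    simp only [h3]
    by_cases hia : i = a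
    · subst hia
      by_cases hjb : j = b
      · subst hjb; by_cases hk : k = c <;> simp [hk, hab, hac, hbc]
      · by_cases hjc : j = c
        · subst hjc
          by_cases hk : k = b <;> simp [hk, hab, hac, hbc, hbc.symm] <;> ring
        · simp [hab, hac, hjb, hjc]
    · by_cases hib : i = b
      · subst hib
        by_cases hja : j = a
        · subst hja; by_cases hk : k = c <;> simp [hk, hia, hac, hbc]; left; ring
        · by_cases hjc : j = c
          · subst hjc
            by_cases hk : k = a <;> simp [hk, hia, hac.symm, hbc] <;> ring
          · simp [hia, hbc, hja, hjc]
      · by_cases hic : i = c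
        · subst hic
          by_cases hja : j = a
          · subst hja; by_cases hk : k = b <;> simp [hk, hia, hib, hab] <;> ring
          · by_cases hjb : j = b
            · subst hjb
              by_cases hk : k = a <;> simp [hk, hia, hib, hab.symm] <;> ring
            · simp [hia, hib, hja, hjb]
        · simp [hia, hib, hic]
  simp only [h4, ← Finset.mul_sum, Finset.sum_add_distrib]
  have h5 : ∀ a b c : V, ∑ i, ∑ j, ∑ k,
      (if i = a then if j = b then if k = c then (1 : ℝ) else 0 else 0 else 0) = 1 := by
    intro a b c
    rw [Finset.sum_eq_single a (fun i _ hi => by simp [hi]) (by simp),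
      Finset.sum_eq_single b (fun i _ hi => by simp [hi]) (by simp)]
    simp
  simp only [h5]
  rw [Finset.prod_insert (by simp [hab, hac]), Finset.prod_insert (by simp [hbc]),
    Finset.prod_singleton]
  ring

end Forms

/-! ### Shifted families at an optimal weighting -/

section Shifted

variable {V : Type*} [Fintype V] [DecidableEq V] {E : Finset (Finset V)}

theorem sum_charW (P : Finset V) : ∑ i, charW P i = #P := by
  simp [charW]

theorem sum_charW_mul (P : Finset V) (x : V → ℝ) : ∑ i, charW P i * x i = ∑ i ∈ P, x i := by
  simp [charW]

theorem sum_distinct_charW (P : Finset V) :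
    ∑ i, ∑ j, ∑ k, (if i ≠ j ∧ i ≠ k ∧ j ≠ k then charW P i * charW P j * charW P k else 0) =
      (#P : ℝ) * (#P - 1) * (#P - 2) := by
  have h2 : ∑ i, charW P i ^ 2 = #P := by
    rw [← sum_charW]
    exact Finset.sum_congr rfl fun i _ => by unfold charW; split_ifs <;> norm_num
  have h3 : ∑ i, charW P i ^ 3 = #P := by
    rw [← sum_charW]
    exact Finset.sum_congr rfl fun i _ => by unfold charW; split_ifs <;> norm_num
  rw [sum_distinct_triples, h2, h3, sum_charW]
  ring

/-- The first order condition for `p` and `v`. Every pair of `Q` is in the link of `p`, so the pairs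
of `Q` missing from the link of `v` make the link of `p` heavier; at an optimum this is
compensated by the edges through both `p` and `v`. The number of missing ordered pairs is
`#Q * (#Q - 1) - linkW E (charW Q) v`, and each of them has weight at least `β ^ 2`. -/
theorem missing_pairs_le (hE : ∀ e ∈ E, #e = 3) {x : V → ℝ} (hx : ∀ i, 0 ≤ x i) {p v : V}
    (hpv : p ≠ v) {Q : Finset V} (hpQ : p ∉ Q) (hvQ : v ∉ Q)
    (hclique : ∀ j ∈ Q, ∀ k ∈ Q, j ≠ k → ({p, j, k} : Finset V) ∈ E)
    (hshift : ∀ j k, p ≠ j → p ≠ k → ({v, j, k} : Finset V) ∈ E → ({p, j, k} : Finset V) ∈ E)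
    {β : ℝ} (hβ : 0 ≤ β) (hβx : ∀ j ∈ Q, β ≤ x j) (hkkt : linkW E x p ≤ linkW E x v) :
    ((#Q : ℝ) * (#Q - 1) - linkW E (charW Q) v) * β ^ 2 ≤
      2 * (x p - x v) * codegW E x p v := by
  have hlow : ((#Q : ℝ) * (#Q - 1) - linkW E (charW Q) v) * β ^ 2 ≤
      ∑ j, ∑ k, (triInd E p j k - triInd E v j k) * (eraseTwo x p v j * eraseTwo x p v k) := by
    have h1 : (#Q : ℝ) * (#Q - 1) - linkW E (charW Q) v =
        ∑ j, ∑ k, ((charW Q j * charW Q k - if k = j then charW Q j else 0) -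
          triInd E v j k * (charW Q j * charW Q k)) := by
      simp only [Finset.sum_sub_distrib, Finset.sum_ite_eq', Finset.mem_univ, if_true,
        ← Finset.mul_sum, sum_charW, ← Finset.sum_mul, linkW, codegW]
      simp only [Finset.sum_mul]
      congr 1
      · ring
      · exact Finset.sum_congr rfl fun j _ => Finset.sum_congr rfl fun k _ => by ring
    rw [h1, Finset.sum_mul]
    refine Finset.sum_le_sum fun j _ => ?_
    rw [Finset.sum_mul]
    refine Finset.sum_le_sum fun k _ => ?_
    have hz : ∀ i, 0 ≤ eraseTwo x p v i := fun i => by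
      unfold eraseTwo; split_ifs; exacts [le_rfl, hx i]
    by_cases hjk : j ∈ Q ∧ k ∈ Q ∧ j ≠ k
    · obtain ⟨hj, hk, hne⟩ := hjk
      have hjx : eraseTwo x p v j = x j :=
        if_neg (by rintro (rfl | rfl) <;> contradiction)
      have hkx : eraseTwo x p v k = x k :=
        if_neg (by rintro (rfl | rfl) <;> contradiction)
      rw [triInd_of_mem (hclique j hj k hk hne), hjx, hkx]
      simp only [charW, hj, hk, hne.symm, if_true, if_false]
      have : β ^ 2 ≤ x j * x k := by
        rw [pow_two]; exact mul_le_mul (hβx j hj) (hβx k hk) hβ (hx j)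
      have h0 : 0 ≤ 1 - triInd E v j k := by linarith [triInd_le_one (E := E) v j k]
      calc _ = (1 - triInd E v j k) * β ^ 2 := by ring
        _ ≤ _ := mul_le_mul_of_nonneg_left this h0
    · have hl : (charW Q j * charW Q k - if k = j then charW Q j else 0) -
          triInd E v j k * (charW Q j * charW Q k) ≤ 0 := by
        have := triInd_nonneg (E := E) v j k
        by_cases hj : j ∈ Q
        · by_cases hk : k ∈ Q
          · have : j = k := by by_contra h; exact hjk ⟨hj, hk, h⟩
            subst this
            simp only [charW, hj, if_true]
            linarith
          · have hkj : k ≠ j := by rintro rfl; exact hk hj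
            simp [charW, hk, hkj]
        · simp [charW, hj]
      refine le_trans (mul_nonpos_of_nonpos_of_nonneg hl (sq_nonneg β)) ?_
      by_cases hj : p = j
      · subst hj; simp [eraseTwo]
      by_cases hk : p = k
      · subst hk; simp [eraseTwo]
      refine mul_nonneg ?_ (mul_nonneg (hz j) (hz k))
      by_cases hm : ({v, j, k} : Finset V) ∈ E
      · rw [triInd_of_mem hm, triInd_of_mem (hshift j k hj hk hm), sub_self]
      · rw [triInd_of_notMem hm, sub_zero]; exact triInd_nonneg _ _ _
  have := linkW_sub_linkW hE x hpv
  linarith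

/-- The first order condition for two vertices `p`, `c` of a clique `P`. Their links differ only in
pairs that meet the complement of `P`, so the gap between their weights is at most the weight of
that complement. -/
theorem sub_le_outer_weight (hE : ∀ e ∈ E, #e = 3) {x : V → ℝ} (hx : ∀ i, 0 ≤ x i) {p c : V}
    {P : Finset V} (hp : p ∈ P) (hc : c ∈ P) (hcp : c ≠ p)
    (hclique : ∀ i ∈ P, ∀ j ∈ P, ∀ k ∈ P, i ≠ j → i ≠ k → j ≠ k → ({i, j, k} : Finset V) ∈ E)
    (hshift : ∀ j k, k ∉ P → p ≠ j → ({c, j, k} : Finset V) ∈ E →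
      ({c, j, p} : Finset V) ∈ E)
    (hkkt : linkW E x p ≤ linkW E x c) (hpos : 0 < codegW E x c p) :
    x c ≤ x p + ∑ i ∈ Pᶜ, x i := by
  have hup : ∑ j, ∑ k, (triInd E c j k - triInd E p j k) *
      (eraseTwo x c p j * eraseTwo x c p k) ≤
      2 * (∑ i ∈ Pᶜ, x i) * codegW E x c p := by
    have h1 : 2 * (∑ i ∈ Pᶜ, x i) * codegW E x c p =
        ∑ j, ∑ k, ((triInd E c p j * x j) * (charW Pᶜ k * x k) +
          (charW Pᶜ j * x j) * (triInd E c p k * x k)) := by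
      rw [← sum_charW_mul, codegW]
      simp only [Finset.sum_add_distrib, ← Finset.mul_sum, ← Finset.sum_mul]
      ring
    rw [h1]
    refine Finset.sum_le_sum fun j _ => Finset.sum_le_sum fun k _ => ?_
    have hnn : 0 ≤ (triInd E c p j * x j) * (charW Pᶜ k * x k) +
          (charW Pᶜ j * x j) * (triInd E c p k * x k) :=
      add_nonneg
        (mul_nonneg (mul_nonneg (triInd_nonneg _ _ _) (hx j)) (mul_nonneg (charW_nonneg _ _) (hx k)))
        (mul_nonneg (mul_nonneg (charW_nonneg _ _) (hx j)) (mul_nonneg (triInd_nonneg _ _ _) (hx k)))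
    by_cases hj : j = c ∨ j = p
    · rw [show eraseTwo x c p j = 0 from if_pos hj]; simpa using hnn
    by_cases hk : k = c ∨ k = p
    · rw [show eraseTwo x c p k = 0 from if_pos hk]; simpa using hnn
    rw [show eraseTwo x c p j = x j from if_neg hj, show eraseTwo x c p k = x k from if_neg hk]
    push Not at hj hk
    by_cases hm : ({c, j, k} : Finset V) ∈ E
    swap
    · refine le_trans ?_ hnn
      rw [triInd_of_notMem hm, zero_sub, neg_mul]
      exact neg_nonpos.2 (mul_nonneg (triInd_nonneg _ _ _) (mul_nonneg (hx j) (hx k)))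
    have hjk : j ≠ k := (distinct_of_triple_mem hE hm).2.2
    have hle : (triInd E c j k - triInd E p j k) * (x j * x k) ≤ x j * x k := by
      have h0 := mul_nonneg (hx j) (hx k)
      refine mul_le_of_le_one_left h0 ?_
      linarith [triInd_le_one (E := E) c j k, triInd_nonneg (E := E) p j k]
    by_cases hkP : k ∈ P
    · by_cases hjP : j ∈ P
      · rw [triInd_of_mem hm, triInd_of_mem (hclique p hp j hjP k hkP hj.2.symm hk.2.symm hjk),
          sub_self, zero_mul]
        exact hnn
      · have h2 : triInd E c p k = 1 :=
          triInd_of_mem (hclique c hc p hp k hkP hcp hk.1.symm hk.2.symm)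
        refine hle.trans ?_
        simp only [charW, Finset.mem_compl, hjP, hkP, h2]
        simp
    · have h2 : triInd E c p j = 1 := by
        rw [triInd_swap_right]
        exact triInd_of_mem (hshift j k hkP hj.2.symm hm)
      refine hle.trans ?_
      have := mul_nonneg (mul_nonneg (charW_nonneg Pᶜ j) (hx j))
        (mul_nonneg (triInd_nonneg (E := E) c p k) (hx k))
      simp only [h2, one_mul]
      rw [show charW Pᶜ k = 1 from if_pos (Finset.mem_compl.2 hkP), one_mul]
      linarith
  have := linkW_sub_linkW hE x hcp
  have h3 : (x c - x p) * codegW E x c p ≤ (∑ i ∈ Pᶜ, x i) * codegW E x c p := by nlinarith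
  have := le_of_mul_le_mul_right h3 hpos
  linarith

theorem six_mul_card (hE : ∀ e ∈ E, #e = 3) :
    6 * (#E : ℝ) = ∑ i, ∑ j, ∑ k, triInd E i j k := by
  have h := cubicForm_eq_six_mul_sum hE (fun _ => 1)
  rw [cubicForm_eq_sum] at h
  simpa using h.symm

/-- The edges inside the clique `P` and the edges `{w, j, k}` with `w ∈ O`, `j, k ∈ P` are all
different. If the link of each `w ∈ O` contains the pairs of `P` in the link of `v`, this
bounds the number of edges from below. -/
theorem count_edges (hE : ∀ e ∈ E, #e = 3) {P O : Finset V} (hPO : Disjoint P O) {v : V}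
    (hclique : ∀ i ∈ P, ∀ j ∈ P, ∀ k ∈ P, i ≠ j → i ≠ k → j ≠ k → ({i, j, k} : Finset V) ∈ E)
    (hshift : ∀ w ∈ O, ∀ j ∈ P, ∀ k ∈ P, ({v, j, k} : Finset V) ∈ E →
      ({w, j, k} : Finset V) ∈ E) :
    (#P : ℝ) * (#P - 1) * (#P - 2) + 3 * (#O * linkW E (charW P) v) ≤ 6 * #E := by
  have hl : #O * linkW E (charW P) v =
      ∑ i, ∑ j, ∑ k, charW O i * (triInd E v j k * (charW P j * charW P k)) := by
    simp only [← Finset.mul_sum, ← Finset.sum_mul, sum_charW, linkW, codegW]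
    congr 1
    simp only [Finset.sum_mul]
    exact Finset.sum_congr rfl fun j _ => Finset.sum_congr rfl fun k _ => by ring
  have hl2 : ∑ i, ∑ j, ∑ k, charW O j * (triInd E v i k * (charW P i * charW P k)) =
      #O * linkW E (charW P) v := by rw [hl, Finset.sum_comm]
  have hl3 : ∑ i, ∑ j, ∑ k, charW O k * (triInd E v i j * (charW P i * charW P j)) =
      #O * linkW E (charW P) v := by
    rw [← hl2]
    exact Finset.sum_congr rfl fun i _ => Finset.sum_comm
  have hsum : (#P : ℝ) * (#P - 1) * (#P - 2) + 3 * (#O * linkW E (charW P) v) =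
      ∑ i, ∑ j, ∑ k, ((if i ≠ j ∧ i ≠ k ∧ j ≠ k then charW P i * charW P j * charW P k else 0) +
        charW O i * (triInd E v j k * (charW P j * charW P k)) +
        charW O j * (triInd E v i k * (charW P i * charW P k)) +
        charW O k * (triInd E v i j * (charW P i * charW P j))) := by
    simp only [Finset.sum_add_distrib]
    rw [sum_distinct_charW, ← hl, hl2, hl3]
    ring
  rw [hsum, six_mul_card hE]
  refine Finset.sum_le_sum fun i _ => Finset.sum_le_sum fun j _ => Finset.sum_le_sum fun k _ => ?_
  have hO : ∀ i ∈ P, charW O i = 0 := fun i hi => if_neg (Finset.disjoint_left.1 hPO hi)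
  have hP1 : ∀ i ∈ P, charW P i = 1 := fun i hi => if_pos hi
  have hP0 : ∀ i, i ∉ P → charW P i = 0 := fun i hi => if_neg hi
  have hone : ∀ w, ∀ j ∈ P, ∀ k ∈ P, charW O w * triInd E v j k ≤ triInd E w j k := by
    intro w j hj k hk
    by_cases hw : w ∈ O
    · rw [show charW O w = 1 from if_pos hw, one_mul]
      by_cases hm : ({v, j, k} : Finset V) ∈ E
      · rw [triInd_of_mem hm, triInd_of_mem (hshift w hw j hj k hk hm)]
      · rw [triInd_of_notMem hm]; exact triInd_nonneg _ _ _
    · rw [show charW O w = 0 from if_neg hw, zero_mul]; exact triInd_nonneg _ _ _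
  by_cases hi : i ∈ P <;> by_cases hj : j ∈ P <;> by_cases hk : k ∈ P
  · rw [hO i hi, hO j hj, hO k hk, hP1 i hi, hP1 j hj, hP1 k hk]
    split_ifs with h
    · rw [triInd_of_mem (hclique i hi j hj k hk h.1 h.2.1 h.2.2)]; norm_num
    · have := triInd_nonneg (E := E) i j k
      linarith
  · rw [hO i hi, hO j hj, hP1 i hi, hP1 j hj, hP0 k hk]
    have := hone k i hi j hj
    rw [triInd_swap_right i j k, triInd_swap_left i k j]
    simpa using this
  · rw [hO i hi, hO k hk, hP1 i hi, hP1 k hk, hP0 j hj]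
    have := hone j i hi k hk
    rw [triInd_swap_left i j k]
    simpa using this
  · rw [hP1 i hi, hP0 j hj, hP0 k hk]
    simpa using triInd_nonneg (E := E) i j k
  · rw [hO j hj, hO k hk, hP1 j hj, hP1 k hk, hP0 i hi]
    simpa using hone i j hj k hk
  all_goals
    simp only [hP0 i hi]
    try simp only [hP0 j hj]
    try simp only [hP0 k hk]
    simpa using triInd_nonneg (E := E) i j k

/-- The optimality argument. `P` consists of the `t` first vertices in an order of decreasing
weight, `E` contains the clique on `P` and is closed under replacing a vertex of an edge by an
earlier one, and `x` satisfies the first order conditions. With `p` the last vertex of `P` and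
`v ∉ P` the last vertex of positive weight, the first order conditions and the number of edges
leave only the case of a single positive vertex `v` outside `P` that has no edge in common with
`p`. In that case the weight of `v` can be moved to `p`, so that `cubicForm_le_of_support`
applies. -/
theorem cubicForm_le_of_shifted (hE : ∀ e ∈ E, #e = 3) {x : V → ℝ} (hx : ∀ i, 0 ≤ x i)
    (hx1 : ∑ i, x i = 1) {t n : ℕ} (ht : 4 ≤ t) (r : V ≃ Fin n) {P : Finset V} (hPt : #P = t)
    (hP : ∀ i, i ∈ P ↔ (r i : ℕ) < t) (hanti : ∀ i j, r i < r j → x j ≤ x i)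
    (hclique : ∀ i ∈ P, ∀ j ∈ P, ∀ k ∈ P, i ≠ j → i ≠ k → j ≠ k → ({i, j, k} : Finset V) ∈ E)
    (hshift : ∀ i j a b, r i < r j → i ≠ a → i ≠ b → ({j, a, b} : Finset V) ∈ E →
      ({i, a, b} : Finset V) ∈ E)
    (hkkt : ∀ i j, 0 < x j → linkW E x i ≤ linkW E x j)
    (hcard : 6 * (#E : ℝ) ≤ (t : ℝ) * (t - 1) * (t - 2) + 3 * (((t : ℝ) - 1) * (t - 2))) :
    cubicForm E x ≤ ((t : ℝ) - 1) * (t - 2) / t ^ 2 := by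
  by_cases hO : ∀ i, i ∉ P → x i = 0
  · exact cubicForm_le_of_support hE hx hx1 ht hPt hO
  push Not at hO
  obtain ⟨i₀, hi₀P, hi₀⟩ := hO
  have ht4 : (4 : ℝ) ≤ t := by exact_mod_cast ht
  obtain ⟨v, hvmem, hvmax⟩ := Finset.exists_max_image (univ.filter fun i => 0 < x i) (fun i => r i)
    ⟨i₀, by simpa using lt_of_le_of_ne (hx i₀) hi₀.symm⟩
  have hxv : 0 < x v := by simpa using hvmem
  have hlast : ∀ i, r v < r i → x i = 0 := by
    intro i hi
    by_contra h
    have := hvmax i (by simpa using lt_of_le_of_ne (hx i) (Ne.symm h))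
    exact absurd hi (not_lt.2 this)
  have hvt : t ≤ (r v : ℕ) := by
    have h1 := hvmax i₀ (by simpa using lt_of_le_of_ne (hx i₀) hi₀.symm)
    have h2 : t ≤ (r i₀ : ℕ) := by rw [hP] at hi₀P; omega
    exact h2.trans (Fin.le_def.1 h1)
  have hvP : v ∉ P := by rw [hP]; omega
  have htn : t - 1 < n := by have := (r v).isLt; omega
  set p : V := r.symm ⟨t - 1, htn⟩ with hp
  have hrp : (r p : ℕ) = t - 1 := by simp [hp]
  have hpP : p ∈ P := by rw [hP, hrp]; omega
  have hpv : p ≠ v := by rintro h; exact hvP (h ▸ hpP)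
  have hout : ∀ i, i ∉ P → r p < r i := by
    intro i hi
    rw [hP] at hi
    rw [Fin.lt_def, hrp]
    omega
  have hin : ∀ i ∈ P, i ≠ p → r i < r p := by
    intro i hi hip
    have h1 : r i ≠ r p := fun h => hip (r.injective h)
    have h2 : (r i : ℕ) ≠ r p := fun h => h1 (Fin.ext h)
    rw [hP] at hi
    rw [Fin.lt_def, hrp]
    omega
  have hmin : ∀ i ∈ P, x p ≤ x i := by
    intro i hi
    by_cases h : i = p
    · rw [h]
    · exact hanti _ _ (hin i hi h)
  have hxvp : x v ≤ x p := hanti _ _ (hout v hvP)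
  have hxp : 0 < x p := hxv.trans_le hxvp
  set Q := P.erase p with hQ
  have hQt : (#Q : ℝ) = t - 1 := by
    rw [hQ, Finset.card_erase_of_mem hpP, hPt, Nat.cast_sub (by omega), Nat.cast_one]
  have hpQ : p ∉ Q := Finset.notMem_erase p P
  have hvQ : v ∉ Q := fun h => hvP (Finset.mem_of_mem_erase h)
  set O := univ.filter (fun i => t ≤ (r i : ℕ) ∧ r i ≤ r v) with hOdef
  have hvO : v ∈ O := by simp [hOdef, hvt]
  have hPO : Disjoint P O := by
    rw [Finset.disjoint_left]
    intro i hi hiO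
    rw [hP] at hi
    simp only [hOdef, Finset.mem_filter] at hiO
    omega
  have hK1 : (1 : ℝ) ≤ #O := by exact_mod_cast Finset.card_pos.2 ⟨v, hvO⟩
  have hvnot : ∀ j ∈ P, j ≠ v := fun j hj h => hvP (h ▸ hj)
  -- `O` consists of the vertices outside `P` up to `v`; by shifting, their links contain that of `v`
  have hcount : #O * linkW E (charW P) v ≤ ((t : ℝ) - 1) * (t - 2) := by
    have h := count_edges hE hPO (v := v) hclique (by
      intro w hw j hj k hk hm
      by_cases hwv : w = v
      · rw [hwv]; exact hm
      · have hwO := (Finset.mem_filter.1 hw).2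
        have hlt : r w < r v := lt_of_le_of_ne hwO.2 fun h => hwv (r.injective h)
        have hwP : w ∉ P := fun h => Finset.disjoint_left.1 hPO h hw
        exact hshift w v j k hlt (fun h => hwP (h ▸ hj)) (fun h => hwP (h ▸ hk)) hm)
    rw [hPt] at h
    linarith
  have hchar : charW P = charW Q + Pi.single p 1 := by
    funext i
    by_cases h : i = p
    · subst h; simp [charW, hpP, hpQ]
    · simp [charW, hQ, h]
  have hlinkP : linkW E (charW P) v = linkW E (charW Q) v + 2 * codegW E (charW Q) p v := by
    rw [hchar, linkW_add_single hE, codegW_comm _ v p]; ring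
  -- `Λ` and `c` count the ordered pairs of `Q`, and the vertices of `Q` next to `p`, in the link of `v`
  set Λ := linkW E (charW Q) v
  set c := codegW E (charW Q) p v with hcdef
  have hΛ0 : 0 ≤ Λ := linkW_nonneg (charW_nonneg Q) v
  have hc0 : 0 ≤ c := codegW_nonneg (charW_nonneg Q) p v
  have hmiss := missing_pairs_le hE hx hpv hpQ hvQ
    (fun j hj k hk hjk => hclique p hpP j (Finset.mem_of_mem_erase hj) k
      (Finset.mem_of_mem_erase hk) (Finset.ne_of_mem_erase hj).symm
      (Finset.ne_of_mem_erase hk).symm hjk)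
    (fun j k hj hk hm => hshift p v j k (hout v hvP) hj hk hm)
    hxp.le (fun j hj => hmin j (Finset.mem_of_mem_erase hj)) (hkkt p v hxv)
  rw [hQt] at hmiss
  -- every vertex of `O` weighs at most as much as `p`
  have hY : ∑ i ∈ Pᶜ, x i ≤ (#O - 1) * x p + x v := by
    have h1 : ∑ i, (charW O i * x p + (if i = v then x v - x p else 0)) =
        (#O - 1) * x p + x v := by
      rw [Finset.sum_add_distrib, ← Finset.sum_mul, sum_charW]
      simp
      ring
    rw [← h1, ← sum_charW_mul]
    refine Finset.sum_le_sum fun i _ => ?_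
    by_cases hi : i ∈ P
    · have hiO : i ∉ O := Finset.disjoint_left.1 hPO hi
      simp [charW, hi, hiO, hvnot i hi]
    · by_cases hiv : i = v
      · subst hiv; simp [charW, hi, hvO]
      · by_cases hlt : r v < r i
        · have : i ∉ O := fun h => absurd (Finset.mem_filter.1 h).2.2 (not_le.2 hlt)
          simp [charW, hi, hiv, hlast i hlt, this]
        · have hiO : i ∈ O := by
            rw [hP] at hi
            simp only [hOdef, Finset.mem_filter, Finset.mem_univ, true_and]
            exact ⟨by omega, not_lt.1 hlt⟩
          simpa [charW, hi, hiv, hiO] using hanti _ _ (hout i hi)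
  have hup : ∀ k ∈ Q, x k ≤ x p + ∑ i ∈ Pᶜ, x i := by
    intro k hk
    have hkP := Finset.mem_of_mem_erase hk
    have hkp := Finset.ne_of_mem_erase hk
    refine sub_le_outer_weight hE hx hpP hkP hkp hclique ?_
      (hkkt p k (hxp.trans_le (hmin k hkP))) ?_
    · intro j l hl hj hm
      have hkl : l ≠ k := fun h => hl (h ▸ hkP)
      have h1 : ({l, k, j} : Finset V) ∈ E := by
        rw [Finset.insert_comm, Finset.pair_comm]; exact hm
      have h2 := hshift p l k j (hout l hl) hkp.symm hj h1
      rwa [Finset.insert_comm, Finset.pair_comm] at h2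
    · obtain ⟨a, haP, hak, hap⟩ : ∃ a ∈ P, a ≠ k ∧ a ≠ p := by
        have : 0 < #((P.erase k).erase p) := by
          have h1 := Finset.pred_card_le_card_erase (s := P.erase k) (a := p)
          have h2 := Finset.pred_card_le_card_erase (s := P) (a := k)
          omega
        obtain ⟨a, ha⟩ := Finset.card_pos.1 this
        simp only [Finset.mem_erase] at ha
        exact ⟨a, ha.2.2, ha.2.1, ha.1⟩
      have h1 : triInd E k p a * x a ≤ codegW E x k p :=
        Finset.single_le_sum (f := fun l => triInd E k p l * x l)
          (fun l _ => mul_nonneg (triInd_nonneg _ _ _) (hx l)) (Finset.mem_univ a)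
      rw [triInd_of_mem (hclique k hkP p hpP a haP hkp hak.symm hap.symm), one_mul] at h1
      exact (hxp.trans_le (hmin a haP)).trans_le h1
  -- an edge through `p`, `v` and a third vertex outside `P` would put, by shifting, all the pairs
  -- of `P` into the link of `v`, which is too many
  have hno : ∀ w, w ∉ P → ({p, v, w} : Finset V) ∉ E := by
    intro w hw hm
    have hall : ∀ a ∈ P, ∀ b ∈ P, a ≠ b → ({v, a, b} : Finset V) ∈ E := by
      have h1 : ∀ a ∈ P, a ≠ p → ({v, a, p} : Finset V) ∈ E := by
        intro a ha hap
        have h2 : ({w, v, p} : Finset V) ∈ E := by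
          rw [Finset.pair_comm, Finset.insert_comm, Finset.pair_comm w v]; exact hm
        have h3 := hshift a w v p ((hin a ha hap).trans (hout w hw)) (hvnot a ha) hap h2
        rwa [Finset.insert_comm] at h3
      intro a ha b hb hab
      by_cases hap : a = p
      · subst hap; rw [Finset.pair_comm]; exact h1 b hb hab.symm
      · by_cases hbp : b = p
        · subst hbp; exact h1 a ha hap
        · have h2 : ({p, v, a} : Finset V) ∈ E := by
            rw [Finset.insert_comm, Finset.pair_comm]; exact h1 a ha hap
          have h3 := hshift b p v a (hin b hb hbp) (hvnot b hb) hab.symm h2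
          rwa [Finset.insert_comm, Finset.pair_comm] at h3
    have hfull : linkW E (charW P) v = (t : ℝ) * (t - 1) := by
      have h1 : ∀ j k, triInd E v j k * (charW P j * charW P k) =
          charW P j * charW P k - if k = j then charW P j else 0 := by
        intro j k
        by_cases hj : j ∈ P
        · by_cases hk : k ∈ P
          · by_cases hjk : k = j
            · subst hjk; simp [triInd_self_right hE, charW, hk]
            · simp [charW, hj, hk, hjk, triInd_of_mem (hall j hj k hk (Ne.symm hjk))]
          · have hkj : k ≠ j := by rintro rfl; exact hk hj
            simp [charW, hk, hkj]
        · simp [charW, hj]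
      have h2 : linkW E (charW P) v =
          ∑ j, ∑ k, triInd E v j k * (charW P j * charW P k) := by
        simp only [linkW, codegW, Finset.sum_mul]
        exact Finset.sum_congr rfl fun j _ => Finset.sum_congr rfl fun k _ => by ring
      rw [h2]
      simp only [h1, Finset.sum_sub_distrib, Finset.sum_ite_eq', Finset.mem_univ, if_true,
        ← Finset.mul_sum, ← Finset.sum_mul, sum_charW, hPt]
      ring
    rw [hfull] at hcount
    nlinarith
  have hW : codegW E x p v ≤ c * (x p + ∑ i ∈ Pᶜ, x i) := by
    rw [hcdef, codegW, codegW, Finset.sum_mul]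
    refine Finset.sum_le_sum fun k _ => ?_
    by_cases hk : k ∈ Q
    · rw [show charW Q k = 1 from if_pos hk, mul_one]
      exact mul_le_mul_of_nonneg_left (hup k hk) (triInd_nonneg _ _ _)
    · rw [show charW Q k = 0 from if_neg hk, mul_zero, zero_mul]
      by_cases hkp : k = p
      · subst hkp; rw [triInd_self_outer hE, zero_mul]
      · have hkP : k ∉ P := fun h => hk (Finset.mem_erase.2 ⟨hkp, h⟩)
        rw [triInd_of_notMem (hno k hkP), zero_mul]
  have hW0 : 0 ≤ codegW E x p v := codegW_nonneg hx p v
  set W := codegW E x p v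
  set Y := ∑ i ∈ Pᶜ, x i
  set K : ℝ := (#O : ℝ) with hKdef
  rw [hlinkP] at hcount
  -- `m` is the number of ordered pairs of `Q` missing from the link of `v`
  set m := ((t : ℝ) - 1) * (t - 1 - 1) - Λ with hm
  have h1 : 2 * (K * c) ≤ m := by
    have := mul_nonneg (sub_nonneg.2 hK1) hΛ0
    nlinarith
  have hcK : c ≤ K * c := le_mul_of_one_le_left hc0 hK1
  have h2 : 2 * W ≤ m * (x p + x v) := by
    have h3 : c * (x p + Y) ≤ c * (K * x p + x v) :=
      mul_le_mul_of_nonneg_left (by linarith) hc0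
    have h4 : 2 * (K * c) * x p ≤ m * x p := mul_le_mul_of_nonneg_right h1 hxp.le
    have h5 : 2 * c * x v ≤ m * x v := mul_le_mul_of_nonneg_right (by linarith) hxv.le
    nlinarith
  -- `hmiss` and `h2` give `m * x p ^ 2 ≤ m * (x p ^ 2 - x v ^ 2)`
  have hm0 : m = 0 := by
    have h3 : (x p - x v) * (2 * W) ≤ (x p - x v) * (m * (x p + x v)) :=
      mul_le_mul_of_nonneg_left h2 (sub_nonneg.2 hxvp)
    have h4 : m * x v ^ 2 ≤ 0 := by nlinarith
    have h5 : 0 < x v ^ 2 := by positivity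
    have h6 : 0 ≤ m := by linarith
    by_contra hne
    have : 0 < m * x v ^ 2 := mul_pos (lt_of_le_of_ne h6 (Ne.symm hne)) h5
    linarith
  have hWz : W = 0 := by rw [hm0] at h2; linarith
  have hK : K ≤ 1 := by
    have hc : c = 0 := by linarith
    rw [hc] at hcount
    have hΛ : Λ = ((t : ℝ) - 1) * (t - 2) := by linarith
    have hpos : 0 < ((t : ℝ) - 1) * (t - 2) := mul_pos (by linarith) (by linarith)
    rw [hΛ] at hcount
    nlinarith
  have hOone : #O ≤ 1 := by rw [hKdef] at hK; exact_mod_cast hK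
  -- moving all the weight of `v` to `p` changes nothing, and leaves no weight outside `P`
  have hshiftx := cubicForm_shift hE x p v (x v)
  rw [le_antisymm (hkkt p v hxv) (hkkt v p hxp)] at hshiftx
  have heq : cubicForm E x = cubicForm E (x + Pi.single p (x v) + Pi.single v (-x v)) := by
    rw [hshiftx, show codegW E x p v = 0 from hWz]; ring
  rw [heq]
  refine cubicForm_le_of_support hE (P := P) ?_ ?_ ht hPt ?_
  · intro i
    by_cases hiv : i = v
    · subst hiv; simp [hpv.symm]
    · by_cases hip : i = p
      · subst hip; simp [hiv]; linarith
      · simpa [hiv, hip] using hx i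
  · simp [Finset.sum_add_distrib, hx1]
  · intro i hi
    by_cases hiv : i = v
    · subst hiv; simp [hpv.symm]
    · have hip : i ≠ p := fun h => hi (h ▸ hpP)
      simp only [Pi.add_apply, Pi.single_apply, hiv, hip, if_false, add_zero]
      by_cases hlt : r v < r i
      · exact hlast i hlt
      · exfalso
        refine hiv (Finset.card_le_one.1 hOone i ?_ v hvO)
        rw [hP] at hi
        simp only [hOdef, Finset.mem_filter, Finset.mem_univ, true_and]
        exact ⟨by omega, not_lt.1 hlt⟩

end Shifted

/-! ### Exchanging edges and the theorem of Peng and Zhao -/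

section Extremal

variable {V : Type*} [DecidableEq V] {E : Finset (Finset V)}

/-- The family obtained from `E` by replacing the edge `s ∪ {j}` by `s ∪ {i}` for each `s ∈ S`. -/
def exchange (E S : Finset (Finset V)) (i j : V) : Finset (Finset V) :=
  (E \ S.image (insert j)) ∪ S.image (insert i)

theorem sum_exchange {M : Type*} [AddCommMonoid M] {S : Finset (Finset V)} {i j : V}
    (hS : ∀ s ∈ S, i ∉ s ∧ j ∉ s ∧ insert j s ∈ E ∧ insert i s ∉ E) (f : Finset V → M) :
    ∑ e ∈ exchange E S i j, f e + ∑ s ∈ S, f (insert j s) =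
      ∑ e ∈ E, f e + ∑ s ∈ S, f (insert i s) := by
  have hinj : ∀ a, (∀ s ∈ S, a ∉ s) → Set.InjOn (insert a) (S : Set (Finset V)) := by
    intro a ha s hs s' hs' h
    have := congrArg (fun u => Finset.erase u a) h
    simpa [Finset.erase_insert (ha s hs), Finset.erase_insert (ha s' hs')] using this
  have hdisj : Disjoint (E \ S.image (insert j)) (S.image (insert i)) := by
    rw [Finset.disjoint_right]
    intro e he he'
    obtain ⟨s, hs, rfl⟩ := Finset.mem_image.1 he
    exact (hS s hs).2.2.2 (Finset.mem_sdiff.1 he').1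
  have hsub : S.image (insert j) ⊆ E := by
    intro e he
    obtain ⟨s, hs, rfl⟩ := Finset.mem_image.1 he
    exact (hS s hs).2.2.1
  rw [exchange, Finset.sum_union hdisj, ← Finset.sum_sdiff hsub,
    Finset.sum_image (hinj i fun s hs => (hS s hs).1),
    Finset.sum_image (hinj j fun s hs => (hS s hs).2.1)]
  abel

theorem card_exchange {S : Finset (Finset V)} {i j : V}
    (hS : ∀ s ∈ S, i ∉ s ∧ j ∉ s ∧ insert j s ∈ E ∧ insert i s ∉ E) :
    #(exchange E S i j) = #E := by
  have h := sum_exchange hS (fun _ => 1)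
  simpa using h

theorem card_of_mem_exchange (hE : ∀ e ∈ E, #e = 3) {S : Finset (Finset V)} {i j : V}
    (hS : ∀ s ∈ S, i ∉ s ∧ j ∉ s ∧ insert j s ∈ E ∧ insert i s ∉ E) :
    ∀ e ∈ exchange E S i j, #e = 3 := by
  intro e he
  rcases Finset.mem_union.1 he with h | h
  · exact hE e (Finset.mem_sdiff.1 h).1
  · obtain ⟨s, hs, rfl⟩ := Finset.mem_image.1 h
    have h1 := hE _ (hS s hs).2.2.1
    rw [Finset.card_insert_of_notMem (hS s hs).2.1] at h1
    rw [Finset.card_insert_of_notMem (hS s hs).1, h1]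

theorem sum_prod_le_exchange {S : Finset (Finset V)} {i j : V}
    (hS : ∀ s ∈ S, i ∉ s ∧ j ∉ s ∧ insert j s ∈ E ∧ insert i s ∉ E) {x : V → ℝ}
    (hx : ∀ i, 0 ≤ x i) (hij : x j ≤ x i) :
    ∑ e ∈ E, ∏ i ∈ e, x i ≤ ∑ e ∈ exchange E S i j, ∏ i ∈ e, x i := by
  have h := sum_exchange hS (fun e => ∏ i ∈ e, x i)
  have h1 : ∑ s ∈ S, ∏ l ∈ insert j s, x l ≤ ∑ s ∈ S, ∏ l ∈ insert i s, x l := by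
    refine Finset.sum_le_sum fun s hs => ?_
    rw [Finset.prod_insert (hS s hs).1, Finset.prod_insert (hS s hs).2.1]
    exact mul_le_mul_of_nonneg_right hij (Finset.prod_nonneg fun l _ => hx l)
  linarith

theorem sum_rank_exchange {S : Finset (Finset V)} {i j : V}
    (hS : ∀ s ∈ S, i ∉ s ∧ j ∉ s ∧ insert j s ∈ E ∧ insert i s ∉ E) (r : V → ℕ) :
    ∑ e ∈ exchange E S i j, ∑ l ∈ e, r l + #S * r j = ∑ e ∈ E, ∑ l ∈ e, r l + #S * r i := by
  have h := sum_exchange hS (fun e => ∑ l ∈ e, r l)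
  have h1 : ∀ a, (∀ s ∈ S, a ∉ s) →
      ∑ s ∈ S, ∑ l ∈ insert a s, r l = #S * r a + ∑ s ∈ S, ∑ l ∈ s, r l := by
    intro a ha
    rw [Finset.sum_congr rfl fun s hs => Finset.sum_insert (f := r) (ha s hs),
      Finset.sum_add_distrib]
    simp
  rw [h1 i fun s hs => (hS s hs).1, h1 j fun s hs => (hS s hs).2.1] at h
  omega

variable [Fintype V]

/-- The vertices can be ordered by decreasing weight. -/
theorem exists_antitone_rank (x : V → ℝ) :
    ∃ r : V ≃ Fin (Fintype.card V), ∀ i j, r i < r j → x j ≤ x i := by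
  let e := Fintype.equivFin V
  let σ := Tuple.sort fun a => -x (e.symm a)
  refine ⟨e.trans σ.symm, fun i j hij => ?_⟩
  have h := Tuple.monotone_sort (fun a => -x (e.symm a)) hij.le
  simpa [σ] using h

/-- The first order conditions at a maximum on the simplex. -/
theorem linkW_le_linkW_of_isMaxOn (hE : ∀ e ∈ E, #e = 3) {x : V → ℝ}
    (hx : x ∈ stdSimplex ℝ V) (hmax : ∀ y ∈ stdSimplex ℝ V, cubicForm E y ≤ cubicForm E x)
    (i j : V) (hj : 0 < x j) : linkW E x i ≤ linkW E x j := by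
  by_cases hij : i = j
  · rw [hij]
  by_contra! hlt
  set W := codegW E x i j with hW
  have hW0 : 0 ≤ W := codegW_nonneg hx.1 i j
  set D := linkW E x i - linkW E x j with hD
  have hD0 : 0 < D := sub_pos.2 hlt
  -- for a small shift the linear gain outweighs the quadratic loss
  set θ := min (x j) (D / (4 * (W + 1))) with hθ
  have hθ0 : 0 < θ := lt_min hj (by positivity)
  have hθ1 : θ ≤ x j := min_le_left _ _
  have hθ2 : θ * (4 * (W + 1)) ≤ D := by
    rw [← le_div_iff₀ (by positivity)]; exact min_le_right _ _
  have hmem : x + Pi.single i θ + Pi.single j (-θ) ∈ stdSimplex ℝ V := by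
    refine ⟨fun l => ?_, by simp [Finset.sum_add_distrib, hx.2]⟩
    by_cases hlj : l = j
    · subst hlj; simp [Ne.symm hij]; linarith
    · by_cases hli : l = i
      · subst hli; simp [hlj]; linarith [hx.1 l]
      · simpa [hli, hlj] using hx.1 l
  have h := hmax _ hmem
  rw [cubicForm_shift hE] at h
  have h1 : 3 * θ * D - 6 * θ ^ 2 * W ≤ 0 := by linarith
  have h2 : 0 < 3 * θ * (D - 2 * θ * W) := by
    refine mul_pos (by positivity) ?_
    nlinarith
  nlinarith

theorem continuous_cubicForm (E : Finset (Finset V)) : Continuous (cubicForm E) := by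
  unfold cubicForm linkW codegW
  fun_prop

theorem cast_choose_three_add_choose_two (t : ℕ) (ht : 1 ≤ t) :
    6 * ((t.choose 3 + (t - 1).choose 2 : ℕ) : ℝ) =
      (t : ℝ) * (t - 1) * (t - 2) + 3 * (((t : ℝ) - 1) * (t - 2)) := by
  obtain ⟨k, rfl⟩ := Nat.exists_eq_add_of_le' ht
  rw [Nat.add_sub_cancel, Nat.choose_succ_succ' k 2]
  have h2 : (k.choose 2 : ℝ) = k * (k - 1) / 2 := Nat.cast_choose_two ℝ k
  have h3 : 6 * (k.choose 3 : ℝ) = k * (k - 1) * (k - 2) := by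
    clear h2 ht
    induction k with
    | zero => simp
    | succ k ih =>
      rw [Nat.choose_succ_succ' k 2, Nat.cast_add, mul_add, ih, Nat.cast_choose_two]
      push_cast
      ring
  push_cast
  rw [h2]
  linear_combination h3

/-- If no exchange towards smaller ranks that keeps a clique of order `t` decreases the sum of the
ranks, then the clique consists of the `t` first vertices and the family is shifted, so
that `cubicForm_le_of_shifted` applies. -/
theorem cubicForm_le_of_stable (hE : ∀ e ∈ E, #e = 3) {t n : ℕ} (ht : 4 ≤ t) {P : Finset V}
    (hPt : #P = t) (hPE : powersetCard 3 P ⊆ E) (hcard : #E ≤ t.choose 3 + (t - 1).choose 2)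
    {x : V → ℝ} (hx : x ∈ stdSimplex ℝ V) (r : V ≃ Fin n) (hr : ∀ i j, r i < r j → x j ≤ x i)
    (hmax : ∀ y ∈ stdSimplex ℝ V, cubicForm E y ≤ cubicForm E x)
    (hstep : ∀ i j, r i < r j → ∀ S : Finset (Finset V), ∀ P' : Finset V,
      (∀ s ∈ S, i ∉ s ∧ j ∉ s ∧ insert j s ∈ E ∧ insert i s ∉ E) → #P' = t →
      powersetCard 3 P' ⊆ exchange E S i j →
      ∑ l ∈ P, (r l : ℕ) + #S * (r j : ℕ) ≤ ∑ l ∈ P', (r l : ℕ) + #S * (r i : ℕ)) :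
    cubicForm E x ≤ ((t : ℝ) - 1) * (t - 2) / t ^ 2 := by
  have htn : t ≤ n := by
    have h := Finset.card_le_univ P
    rwa [hPt, Fintype.card_congr r, Fintype.card_fin] at h
  have hP : ∀ i, i ∈ P ↔ (r i : ℕ) < t := by
    have hI : #(univ.filter fun i => (r i : ℕ) < t) = t := by
      rw [← Finset.card_map r.toEmbedding]
      have : (univ.filter fun i => (r i : ℕ) < t).map r.toEmbedding =
          univ.filter fun a : Fin n => (a : ℕ) < t := by
        ext a
        simp only [Finset.mem_map, Finset.mem_filter, Finset.mem_univ, true_and,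
          Equiv.coe_toEmbedding]
        exact ⟨fun ⟨i, hi, h⟩ => h ▸ hi, fun h => ⟨r.symm a, by simpa using h, by simp⟩⟩
      rw [this, Fin.card_filter_val_lt]
      exact min_eq_right htn
    -- otherwise an earlier vertex `i` takes the place of some `j ∈ P`
    suffices hsub : (univ.filter fun i => (r i : ℕ) < t) ⊆ P by
      have := Finset.eq_of_subset_of_card_le hsub (by rw [hI, hPt])
      intro i
      rw [← this]
      simp
    by_contra hsub
    obtain ⟨i, hiI, hiP⟩ := Finset.not_subset.1 hsub
    have hi : (r i : ℕ) < t := (Finset.mem_filter.1 hiI).2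
    obtain ⟨j, hjP, hj⟩ : ∃ j ∈ P, t ≤ (r j : ℕ) := by
      by_contra! h
      refine hsub (Finset.eq_of_subset_of_card_le (s := P) (fun l hl => ?_) (by rw [hI, hPt])).ge
      exact Finset.mem_filter.2 ⟨Finset.mem_univ _, h l hl⟩
    have hij : r i < r j := by rw [Fin.lt_def]; omega
    have hiPj : i ∉ P.erase j := fun h => hiP (Finset.mem_of_mem_erase h)
    set S := (powersetCard 2 (P.erase j)).filter fun s => insert i s ∉ E with hSdef
    have hS : ∀ s ∈ S, i ∉ s ∧ j ∉ s ∧ insert j s ∈ E ∧ insert i s ∉ E := by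
      intro s hs
      obtain ⟨hs1, hs2⟩ := Finset.mem_filter.1 hs
      obtain ⟨hs1, hs3⟩ := Finset.mem_powersetCard.1 hs1
      have hjs : j ∉ s := fun h => Finset.notMem_erase j P (hs1 h)
      refine ⟨fun h => hiPj (hs1 h), hjs, hPE ?_, hs2⟩
      rw [Finset.mem_powersetCard, Finset.card_insert_of_notMem hjs, hs3]
      exact ⟨Finset.insert_subset hjP (hs1.trans (Finset.erase_subset _ _)), rfl⟩
    have hcardP' : #(insert i (P.erase j)) = t := by
      rw [Finset.card_insert_of_notMem hiPj, Finset.card_erase_add_one hjP, hPt]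
    have hclq : powersetCard 3 (insert i (P.erase j)) ⊆ exchange E S i j := by
      intro T hT
      obtain ⟨hT1, hT3⟩ := Finset.mem_powersetCard.1 hT
      have hjT : j ∉ T := by
        intro h
        rcases Finset.mem_insert.1 (hT1 h) with h | h
        · subst h; exact hiP hjP
        · exact Finset.notMem_erase j P h
      by_cases hTE : T ∈ E
      · refine Finset.mem_union_left _ (Finset.mem_sdiff.2 ⟨hTE, fun h => ?_⟩)
        obtain ⟨s, -, rfl⟩ := Finset.mem_image.1 h
        exact hjT (Finset.mem_insert_self _ _)
      · have hiT : i ∈ T := by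
          by_contra hiT
          refine hTE (hPE (Finset.mem_powersetCard.2 ⟨fun l hl => ?_, hT3⟩))
          rcases Finset.mem_insert.1 (hT1 hl) with h | h
          · subst h; exact absurd hl hiT
          · exact Finset.mem_of_mem_erase h
        refine Finset.mem_union_right _ (Finset.mem_image.2 ⟨T.erase i, ?_, Finset.insert_erase hiT⟩)
        rw [hSdef, Finset.mem_filter, Finset.insert_erase hiT, Finset.mem_powersetCard,
          Finset.card_erase_of_mem hiT, hT3]
        exact ⟨⟨by rw [← Finset.subset_insert_iff]; exact hT1, rfl⟩, hTE⟩
    have h := hstep i j hij S _ hS hcardP' hclq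
    rw [Finset.sum_insert hiPj, ← Finset.add_sum_erase P _ hjP] at h
    have : #S * (r i : ℕ) ≤ #S * (r j : ℕ) := Nat.mul_le_mul_left _ (Fin.le_def.1 hij.le)
    rw [Fin.lt_def] at hij
    omega
  have hclique : ∀ i ∈ P, ∀ j ∈ P, ∀ k ∈ P, i ≠ j → i ≠ k → j ≠ k →
      ({i, j, k} : Finset V) ∈ E := by
    intro i hi j hj k hk hij hik hjk
    refine hPE (Finset.mem_powersetCard.2 ⟨?_, Finset.card_eq_three.2 ⟨i, j, k, hij, hik, hjk, rfl⟩⟩)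
    intro l hl
    simp only [Finset.mem_insert, Finset.mem_singleton] at hl
    rcases hl with rfl | rfl | rfl <;> assumption
  have hshift : ∀ i j a b, r i < r j → i ≠ a → i ≠ b → ({j, a, b} : Finset V) ∈ E →
      ({i, a, b} : Finset V) ∈ E := by
    intro i j a b hij hia hib hm
    by_contra hnot
    obtain ⟨hja, hjb, hab⟩ := distinct_of_triple_mem hE hm
    have hS : ∀ s ∈ ({{a, b}} : Finset (Finset V)),
        i ∉ s ∧ j ∉ s ∧ insert j s ∈ E ∧ insert i s ∉ E := by
      intro s hs
      rw [Finset.mem_singleton.1 hs]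
      simp [hia, hib, hja, hjb, hm, hnot]
    have h := hstep i j hij {{a, b}} P hS hPt (by
      intro T hT
      refine Finset.mem_union_left _ (Finset.mem_sdiff.2 ⟨hPE hT, fun h => hnot ?_⟩)
      rw [Finset.image_singleton, Finset.mem_singleton] at h
      subst h
      have hsub := (Finset.mem_powersetCard.1 hT).1
      have hj : j ∈ P := hsub (by simp)
      refine hclique i ?_ a (hsub (by simp)) b (hsub (by simp)) hia hib hab
      rw [hP] at hj ⊢
      exact (Fin.lt_def.1 hij).trans hj)
    rw [Fin.lt_def] at hij
    simp only [Finset.card_singleton] at h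
    omega
  refine cubicForm_le_of_shifted hE hx.1 hx.2 ht r hPt hP hr hclique hshift
    (linkW_le_linkW_of_isMaxOn hE hx hmax) ?_
  rw [← cast_choose_three_add_choose_two t (by omega)]
  have : (#E : ℝ) ≤ ((t.choose 3 + (t - 1).choose 2 : ℕ) : ℝ) := by exact_mod_cast hcard
  linarith

/-- The pairs of a `3`-uniform family with at most `m` edges and a clique of order `t` in it. -/
def cliqueConfigs (V : Type*) [DecidableEq V] (t m : ℕ) :
    Set (Finset (Finset V) × Finset V) :=
  {c | (∀ e ∈ c.1, #e = 3) ∧ #c.2 = t ∧ powersetCard 3 c.2 ⊆ c.1 ∧ #c.1 ≤ m}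

theorem exists_max_cliqueConfigs {t m : ℕ} (hne : (cliqueConfigs V t m).Nonempty)
    (hV : (stdSimplex ℝ V).Nonempty) :
    ∃ c ∈ cliqueConfigs V t m, ∃ x ∈ stdSimplex ℝ V, ∀ c' ∈ cliqueConfigs V t m,
      ∀ y ∈ stdSimplex ℝ V, cubicForm c'.1 y ≤ cubicForm c.1 x := by
  have hex : ∀ E : Finset (Finset V), ∃ y ∈ stdSimplex ℝ V,
      ∀ z ∈ stdSimplex ℝ V, cubicForm E z ≤ cubicForm E y := fun E =>
    (isCompact_stdSimplex ℝ V).exists_isMaxOn hV (continuous_cubicForm E).continuousOn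
  choose X hXmem hXmax using hex
  obtain ⟨c, hc, hmax⟩ := Set.exists_max_image (cliqueConfigs V t m)
    (fun c => cubicForm c.1 (X c.1)) (Set.toFinite _) hne
  exact ⟨c, hc, X c.1, hXmem _, fun c' hc' y hy => (hXmax _ y hy).trans (hmax c' hc')⟩

/-- A `3`-uniform family with a clique of order `t` and at most `(t - 1).choose 2` further edges has
at most the Lagrangian of the clique. This is a theorem of Peng and Zhao; the proof takes a pair of a
family and a weighting that is extremal and, among these, has the smallest sum of ranks. -/
theorem cubicForm_le_of_clique (hE : ∀ e ∈ E, #e = 3) {t : ℕ} (ht : 4 ≤ t) {P : Finset V}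
    (hPt : #P = t) (hPE : powersetCard 3 P ⊆ E) (hcard : #E ≤ t.choose 3 + (t - 1).choose 2)
    {x : V → ℝ} (hx : x ∈ stdSimplex ℝ V) :
    cubicForm E x ≤ ((t : ℝ) - 1) * (t - 2) / t ^ 2 := by
  have hmem : (E, P) ∈ cliqueConfigs V t (t.choose 3 + (t - 1).choose 2) :=
    ⟨hE, hPt, hPE, hcard⟩
  obtain ⟨c₀, hc₀, y, hy, hall⟩ := exists_max_cliqueConfigs ⟨_, hmem⟩ ⟨x, hx⟩
  refine (hall (E, P) hmem x hx).trans ?_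
  obtain ⟨r, hr⟩ := exists_antitone_rank y
  obtain ⟨⟨F, Q⟩, ⟨hc, hFM⟩, hmin⟩ := Set.exists_min_image
    {c ∈ cliqueConfigs V t (t.choose 3 + (t - 1).choose 2) | cubicForm c.1 y = cubicForm c₀.1 y}
    (fun c => ∑ e ∈ c.1, ∑ l ∈ e, (r l : ℕ) + ∑ l ∈ c.2, (r l : ℕ)) (Set.toFinite _)
    ⟨c₀, hc₀, rfl⟩
  obtain ⟨hF, hQt, hQF, hFcard⟩ := hc
  dsimp only at hF hQt hQF hFcard hFM
  rw [← hFM]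
  refine cubicForm_le_of_stable hF ht hQt hQF hFcard hy r hr
    (fun z hz => by rw [hFM]; exact hall (F, Q) ⟨hF, hQt, hQF, hFcard⟩ z hz) ?_
  -- an exchange towards smaller rank that keeps a clique does not decrease the sum of the ranks
  intro i j hij S P' hS hP't hP'E
  have h3 := card_of_mem_exchange hF hS
  have hconf : (exchange F S i j, P') ∈ cliqueConfigs V t (t.choose 3 + (t - 1).choose 2) :=
    ⟨h3, hP't, hP'E, by rw [card_exchange hS]; exact hFcard⟩
  have hge : cubicForm c₀.1 y ≤ cubicForm (exchange F S i j) y := by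
    rw [← hFM, cubicForm_eq_six_mul_sum hF, cubicForm_eq_six_mul_sum h3]
    linarith [sum_prod_le_exchange hS hy.1 (hr i j hij)]
  have hle : cubicForm (exchange F S i j) y ≤ cubicForm c₀.1 y := hall _ hconf y hy
  have h := hmin (exchange F S i j, P') ⟨hconf, le_antisymm hle hge⟩
  have h' := sum_rank_exchange hS fun l => (r l : ℕ)
  dsimp only at h
  omega

end Extremal

/-! ### Families with a larger clique -/

section LargeClique

variable {V : Type*} [Fintype V] [DecidableEq V] {E : Finset (Finset V)}

/-- Dropping the edges that meet `S \ P` takes away all triples of `S` that are not in `P`. -/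
theorem cubicForm_le_of_support_sdiff (hE : ∀ e ∈ E, #e = 3) {t : ℕ} (ht : 4 ≤ t)
    {S P : Finset V} (hSE : powersetCard 3 S ⊆ E)
    (hcard : #E ≤ (#S).choose 3 + (t - 1).choose 2) (hPS : P ⊆ S) (hPt : #P = t) {x : V → ℝ}
    (hx : x ∈ stdSimplex ℝ V) (hzero : ∀ i ∈ S \ P, x i = 0) :
    cubicForm E x ≤ ((t : ℝ) - 1) * (t - 2) / t ^ 2 := by
  set F := E.filter fun e => Disjoint e (S \ P) with hF
  have hFE : F ⊆ E := Finset.filter_subset _ _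
  have hF3 : ∀ e ∈ F, #e = 3 := fun e he => hE e (hFE he)
  have hPP : powersetCard 3 P ⊆ powersetCard 3 S := Finset.powersetCard_mono hPS
  have heq : cubicForm E x = cubicForm F x := by
    rw [cubicForm_eq_six_mul_sum hE, cubicForm_eq_six_mul_sum hF3, hF]
    congr 1
    refine (Finset.sum_subset hFE fun e heE heF => ?_).symm
    have : ¬ Disjoint e (S \ P) := fun h => heF (Finset.mem_filter.2 ⟨heE, h⟩)
    obtain ⟨i, hi, hiS⟩ := Finset.not_disjoint_iff.1 this
    exact Finset.prod_eq_zero hi (hzero i hiS)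
  have hPF : powersetCard 3 P ⊆ F := by
    intro e he
    refine Finset.mem_filter.2 ⟨hSE (hPP he), ?_⟩
    exact Finset.disjoint_of_subset_left (Finset.mem_powersetCard.1 he).1 Finset.disjoint_sdiff
  have hlost : powersetCard 3 S \ powersetCard 3 P ⊆ E \ F := by
    intro e he
    obtain ⟨heS, heP⟩ := Finset.mem_sdiff.1 he
    refine Finset.mem_sdiff.2 ⟨hSE heS, fun heF => heP ?_⟩
    obtain ⟨heS, he3⟩ := Finset.mem_powersetCard.1 heS
    refine Finset.mem_powersetCard.2 ⟨fun i hi => ?_, he3⟩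
    by_contra hiP
    exact Finset.disjoint_left.1 (Finset.mem_filter.1 heF).2 hi
      (Finset.mem_sdiff.2 ⟨heS hi, hiP⟩)
  have h1 := Finset.card_le_card hlost
  have h2 := Finset.card_sdiff_add_card_eq_card hPP
  have h3 := Finset.card_sdiff_add_card_eq_card hFE
  rw [Finset.card_powersetCard, Finset.card_powersetCard, hPt] at h2
  rw [heq]
  exact cubicForm_le_of_clique hF3 ht hPt hPF (by omega) hx

theorem codegW_le_one_sub (hE : ∀ e ∈ E, #e = 3) {x : V → ℝ} (hx : x ∈ stdSimplex ℝ V)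
    (p q : V) : codegW E x p q ≤ 1 - x p := by
  have h : ∑ k, (x k - if k = p then x p else 0) = 1 - x p := by
    rw [Finset.sum_sub_distrib, hx.2]; simp
  rw [← h]
  refine Finset.sum_le_sum fun k _ => ?_
  by_cases hk : k = p
  · subst hk; simp [triInd_self_outer hE]
  · simpa [hk] using mul_le_of_le_one_left (hx.1 k) (triInd_le_one (E := E) p q k)

theorem shift_mem_stdSimplex {x : V → ℝ} (hx : x ∈ stdSimplex ℝ V) {p q : V} (hpq : p ≠ q)
    {θ : ℝ} (hp : -x p ≤ θ) (hq : θ ≤ x q) :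
    x + Pi.single p θ + Pi.single q (-θ) ∈ stdSimplex ℝ V := by
  refine ⟨fun l => ?_, by simp [Finset.sum_add_distrib, hx.2]⟩
  by_cases hlq : l = q
  · subst hlq; simp [Ne.symm hpq]; linarith
  · by_cases hlp : l = p
    · subst hlp; simp [hlq]; linarith
    · simpa [hlp, hlq] using hx.1 l

/-- In a family with a clique `S` larger than `P`, the weight on `S \ P` raises the form by at most
that weight. The induction is on the number of positive vertices of `S \ P`. A positive `q ∈ S \ P`
and a lightest `p ∈ P` are merged, and whichever of them keeps the weight is put into `P`. The
edges through both `p` and `q` get lost, but as `x p ≤ 1 / 5` they contribute at most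
`6 * x p * (1 - x p) * x q ≤ x q`; this is where `5 ≤ t` matters. -/
theorem cubicForm_le_add_sum_sdiff (hE : ∀ e ∈ E, #e = 3) {t : ℕ} (ht : 5 ≤ t) {S : Finset V}
    (hSE : powersetCard 3 S ⊆ E) (hcard : #E ≤ (#S).choose 3 + (t - 1).choose 2) (k : ℕ) :
    ∀ (P : Finset V) (x : V → ℝ), P ⊆ S → #P = t → x ∈ stdSimplex ℝ V →
      #((S \ P).filter fun i => 0 < x i) ≤ k →
      cubicForm E x ≤ ((t : ℝ) - 1) * (t - 2) / t ^ 2 + ∑ i ∈ S \ P, x i := by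
  induction k with
  | zero =>
    intro P x hPS hPt hx hk
    have hzero : ∀ i ∈ S \ P, x i = 0 := by
      intro i hi
      have h := Finset.card_eq_zero.1 (Nat.le_zero.1 hk)
      by_contra hne
      have : i ∈ (S \ P).filter fun i => 0 < x i :=
        Finset.mem_filter.2 ⟨hi, lt_of_le_of_ne (hx.1 i) (Ne.symm hne)⟩
      rw [h] at this
      exact absurd this (Finset.notMem_empty i)
    rw [Finset.sum_eq_zero hzero, add_zero]
    exact cubicForm_le_of_support_sdiff hE (by omega) hSE hcard hPS hPt hx hzero
  | succ k ih =>
    intro P x hPS hPt hx hk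
    by_cases hq : ((S \ P).filter fun i => 0 < x i) = ∅
    · exact ih P x hPS hPt hx (by rw [hq]; simp)
    obtain ⟨q, hqm⟩ := Finset.nonempty_iff_ne_empty.2 hq
    obtain ⟨hqSP, hxq⟩ := Finset.mem_filter.1 hqm
    obtain ⟨hqS, hqP⟩ := Finset.mem_sdiff.1 hqSP
    obtain ⟨p, hpP, hpmin⟩ := Finset.exists_min_image P x (Finset.card_pos.1 (by omega))
    have hpq : p ≠ q := fun h => hqP (h ▸ hpP)
    have hxp0 := hx.1 p
    have hxp : x p ≤ 1 / 5 := by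
      have h1 := Finset.card_nsmul_le_sum P x (x p) hpmin
      have h2 : ∑ i ∈ P, x i ≤ 1 := by
        rw [← hx.2]
        exact Finset.sum_le_sum_of_subset_of_nonneg (Finset.subset_univ P) fun i _ _ => hx.1 i
      rw [hPt, nsmul_eq_mul] at h1
      have ht5 : (5 : ℝ) ≤ t := by exact_mod_cast ht
      nlinarith
    have herase : #(((S \ P).filter fun i => 0 < x i).erase q) ≤ k := by
      rw [Finset.card_erase_of_mem hqm]; omega
    have hsum : ∑ i ∈ (S \ P).erase q, x i = ∑ i ∈ S \ P, x i - x q := by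
      rw [← Finset.add_sum_erase _ _ hqSP]; ring
    set W := codegW E x p q
    set D := linkW E x p - linkW E x q
    -- the whole weight of `q` moves to `p`
    have h1 := ih P (x + Pi.single p (x q) + Pi.single q (-x q)) hPS hPt
      (shift_mem_stdSimplex hx hpq (by linarith) le_rfl) (by
        refine (Finset.card_le_card fun i hi => ?_).trans herase
        obtain ⟨hi1, hi2⟩ := Finset.mem_filter.1 hi
        have hip : i ≠ p := fun h => (Finset.mem_sdiff.1 hi1).2 (h ▸ hpP)
        have hiq : i ≠ q := by
          rintro rfl
          simp [hip] at hi2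
        refine Finset.mem_erase.2 ⟨hiq, Finset.mem_filter.2 ⟨hi1, ?_⟩⟩
        simpa [hip, hiq] using hi2)
    have hs1 : ∑ i ∈ S \ P, (x + Pi.single p (x q) + Pi.single q (-x q) : V → ℝ) i =
        ∑ i ∈ S \ P, x i - x q := by
      rw [← hsum, ← Finset.add_sum_erase _ _ hqSP]
      simp only [Pi.add_apply, Pi.single_eq_same, Pi.single_eq_of_ne hpq.symm]
      rw [add_zero, add_neg_cancel, zero_add]
      refine Finset.sum_congr rfl fun i hi => ?_
      obtain ⟨hiq, hi⟩ := Finset.mem_erase.1 hi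
      have hip : i ≠ p := fun h => (Finset.mem_sdiff.1 hi).2 (h ▸ hpP)
      simp [hip, hiq]
    rw [hs1, cubicForm_shift hE] at h1
    -- the whole weight of `p` moves to `q`, which takes the place of `p`
    have hqe : q ∉ P.erase p := fun h => hqP (Finset.mem_of_mem_erase h)
    have hP' : S \ insert q (P.erase p) = insert p ((S \ P).erase q) := by
      ext i
      simp only [Finset.mem_sdiff, Finset.mem_insert, Finset.mem_erase]
      by_cases hip : i = p
      · subst hip; simp [hPS hpP, hpq]
      · simp [hip]; tauto
    have h2 := ih (insert q (P.erase p)) (x + Pi.single p (-x p) + Pi.single q (-(-x p)))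
      (Finset.insert_subset hqS ((Finset.erase_subset _ _).trans hPS))
      (by rw [Finset.card_insert_of_notMem hqe, Finset.card_erase_add_one hpP, hPt])
      (shift_mem_stdSimplex hx hpq le_rfl (by linarith)) (by
        refine (Finset.card_le_card fun i hi => ?_).trans herase
        rw [hP'] at hi
        obtain ⟨hi1, hi2⟩ := Finset.mem_filter.1 hi
        have hip : i ≠ p := by
          rintro rfl
          simp [hpq] at hi2
        obtain ⟨hiq, hi1⟩ := Finset.mem_erase.1 (Finset.mem_of_mem_insert_of_ne hi1 hip)
        refine Finset.mem_erase.2 ⟨hiq, Finset.mem_filter.2 ⟨hi1, ?_⟩⟩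
        simpa [hip, hiq] using hi2)
    have hs2 : ∑ i ∈ S \ insert q (P.erase p),
        (x + Pi.single p (-x p) + Pi.single q (-(-x p)) : V → ℝ) i = ∑ i ∈ S \ P, x i - x q := by
      have hpn : p ∉ (S \ P).erase q := fun h =>
        (Finset.mem_sdiff.1 (Finset.mem_of_mem_erase h)).2 hpP
      rw [← hsum, hP', Finset.sum_insert hpn]
      simp only [Pi.add_apply, Pi.single_eq_same, Pi.single_eq_of_ne hpq]
      rw [add_zero, add_neg_cancel, zero_add]
      refine Finset.sum_congr rfl fun i hi => ?_
      have hiq := Finset.ne_of_mem_erase hi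
      have hip : i ≠ p := fun h => hpn (h ▸ hi)
      simp [hip, hiq]
    rw [hs2, cubicForm_shift hE] at h2
    have hW0 : 0 ≤ W := codegW_nonneg hx.1 p q
    have hW1 : W ≤ 1 - x p := codegW_le_one_sub hE hx p q
    have h6 : 6 * (x p * W) ≤ 1 := by
      have := mul_le_mul_of_nonneg_left hW1 hxp0
      nlinarith
    set B := ((t : ℝ) - 1) * (t - 2) / t ^ 2 + (∑ i ∈ S \ P, x i - x q) with hB
    -- `x` is the average of the two shifted weightings with weights `x p` and `x q`
    have h3 : (x p + x q) * cubicForm E x ≤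
        (x p + x q) * (B + 6 * (x p * W) * x q) := by
      have h4 := mul_le_mul_of_nonneg_left h1 hxp0
      have h5 := mul_le_mul_of_nonneg_left h2 hxq.le
      nlinarith
    have h7 := le_of_mul_le_mul_left h3 (by linarith)
    have h8 : 6 * (x p * W) * x q ≤ x q := mul_le_of_le_one_left hxq.le h6
    rw [hB] at h7
    linarith

end LargeClique

/-! ### Lagrangians of `{1, 3}`-graphs -/

section Transfer

variable {α : Type*} (H : Hypergraph α) [Fintype H.vertexSet]

open scoped Classical in
/-- The edges with three vertices, as finite sets of vertices. -/
noncomputable def tripleFamily : Finset (Finset H.vertexSet) :=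
  univ.filter fun e => #e = 3 ∧ Subtype.val '' (e : Set H.vertexSet) ∈ H.edgeSet

open scoped Classical in
/-- The vertices that form an edge on their own. -/
noncomputable def loopVertices : Finset H.vertexSet :=
  univ.filter fun v => ({v.1} : Set α) ∈ H.edgeSet

theorem mem_tripleFamily {e : Finset H.vertexSet} :
    e ∈ H.tripleFamily ↔ #e = 3 ∧ Subtype.val '' (e : Set H.vertexSet) ∈ H.edgeSet := by
  simp [tripleFamily]

theorem mem_loopVertices {v : H.vertexSet} :
    v ∈ H.loopVertices ↔ ({v.1} : Set α) ∈ H.edgeSet := by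
  simp [loopVertices]

theorem image_val_injective :
    Function.Injective fun e : Finset H.vertexSet => Subtype.val '' (e : Set H.vertexSet) :=
  fun _ _ h => Finset.coe_injective (Set.image_injective.2 Subtype.val_injective h)

theorem exists_finset_image_val {e : Set α} (he : e ⊆ H.vertexSet) :
    ∃ f : Finset H.vertexSet, Subtype.val '' (f : Set H.vertexSet) = e := by
  classical
  refine ⟨(Set.toFinite (Subtype.val ⁻¹' e : Set H.vertexSet)).toFinset, ?_⟩
  rw [Set.Finite.coe_toFinset, Subtype.image_preimage_coe, Set.inter_eq_right]
  exact he

theorem ncard_image_val (f : Finset H.vertexSet) :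
    (Subtype.val '' (f : Set H.vertexSet)).ncard = #f := by
  rw [Set.ncard_image_of_injective _ Subtype.val_injective, Set.ncard_coe_finset]

theorem level_three_edgeSet : (H.level 3).edgeSet =
    (fun e : Finset H.vertexSet => Subtype.val '' (e : Set H.vertexSet)) '' H.tripleFamily := by
  ext e
  constructor
  · rintro ⟨he, h3⟩
    obtain ⟨f, rfl⟩ := H.exists_finset_image_val (H.subset_vertexSet_of_mem_edgeSet' he)
    rw [ncard_image_val] at h3
    exact ⟨f, H.mem_tripleFamily.2 ⟨h3, he⟩, rfl⟩
  · rintro ⟨f, hf, rfl⟩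
    obtain ⟨h3, he⟩ := H.mem_tripleFamily.1 hf
    exact ⟨he, by rw [ncard_image_val, h3]⟩

theorem level_one_edgeSet : (H.level 1).edgeSet =
    (fun v : H.vertexSet => ({v.1} : Set α)) '' H.loopVertices := by
  ext e
  constructor
  · rintro ⟨he, h1⟩
    obtain ⟨a, rfl⟩ := Set.ncard_eq_one.1 h1
    have ha : a ∈ H.vertexSet := H.subset_vertexSet_of_mem_edgeSet' he rfl
    exact ⟨⟨a, ha⟩, H.mem_loopVertices.2 he, rfl⟩
  · rintro ⟨v, hv, rfl⟩
    exact ⟨H.mem_loopVertices.1 hv, Set.ncard_singleton _⟩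

theorem card_tripleFamily : #H.tripleFamily = (H.level 3).numEdges := by
  rw [numEdges, level_three_edgeSet, Set.ncard_image_of_injective _ H.image_val_injective,
    Set.ncard_coe_finset]

theorem lagrangianPoly_eq [DecidableEq H.vertexSet] (hR : H.edgeTypes = {1, 3}) (x : α → ℝ) :
    H.lagrangianPoly x =
      ∑ v ∈ H.loopVertices, x v.1 + cubicForm H.tripleFamily fun v => x v.1 := by
  have h1 : ∑ᶠ e ∈ (H.level 1).edgeSet, ∏ᶠ v ∈ e, x v = ∑ v ∈ H.loopVertices, x v.1 := by
    rw [level_one_edgeSet, finsum_mem_image, finsum_mem_coe_finset]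
    · simp
    · intro v _ w _ h
      exact Subtype.ext (Set.singleton_injective h)
  have h3 : ∑ᶠ e ∈ (H.level 3).edgeSet, ∏ᶠ v ∈ e, x v =
      ∑ e ∈ H.tripleFamily, ∏ v ∈ e, x v.1 := by
    rw [level_three_edgeSet, finsum_mem_image H.image_val_injective.injOn, finsum_mem_coe_finset]
    refine Finset.sum_congr rfl fun e _ => ?_
    rw [finprod_mem_image Subtype.val_injective.injOn, finprod_mem_coe_finset]
  rw [lagrangianPoly, hR, finsum_mem_pair (by norm_num), h1, h3,
    cubicForm_eq_six_mul_sum fun e he => (H.mem_tripleFamily.1 he).1]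
  norm_num [Nat.factorial]

theorem finsum_vertexSet_eq (x : α → ℝ) :
    ∑ᶠ v ∈ H.vertexSet, x v = ∑ v : H.vertexSet, x v.1 := by
  rw [← finsum_set_coe_eq_finsum_mem, finsum_eq_sum_of_fintype]

/-- At most `t` of the vertices of a clique `S` of `H^3` are edges of their own, since these form a
complete `{1, 3}`-subgraph. They lie in a subset `P` of `S` with `t` elements, and the weight on
`S \ P` is lost in the linear part of the polynomial, which makes up for the gain in
`cubicForm_le_add_sum_sdiff`. -/
theorem lagrangianPoly_le (hR : H.edgeTypes = {1, 3}) {t s : ℕ} (ht : 5 ≤ t) (hts : t ≤ s)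
    (hmaxt : ∀ k ∈ H.completeSubgraphOrders {1, 3}, k ≤ t)
    (hs : s ∈ (H.level 3).completeSubgraphOrders {3})
    (hupper : (H.level 3).numEdges ≤ s.choose 3 + (t - 1).choose 2) {x : α → ℝ}
    (hx : x ∈ H.legalWeightings) :
    H.lagrangianPoly x ≤ 1 + ((t : ℝ) - 1) * (t - 2) / t ^ 2 := by
  classical
  obtain ⟨S₀, hS₀, hSV, hSE⟩ := hs
  obtain ⟨S, rfl⟩ := H.exists_finset_image_val hSV
  rw [ncard_image_val] at hS₀
  have hE : ∀ e ∈ H.tripleFamily, #e = 3 := fun e he => (H.mem_tripleFamily.1 he).1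
  have hSE' : powersetCard 3 S ⊆ H.tripleFamily := by
    intro e he
    obtain ⟨heS, he3⟩ := Finset.mem_powersetCard.1 he
    refine H.mem_tripleFamily.2 ⟨he3, (hSE (a := Subtype.val '' (e : Set H.vertexSet)) ?_).1⟩
    exact ⟨Set.image_mono (Finset.coe_subset.2 heS), by rw [ncard_image_val]; exact he3⟩
  have hLS : #(H.loopVertices ∩ S) ≤ t := by
    refine hmaxt _ ⟨Subtype.val '' ((H.loopVertices ∩ S : Finset H.vertexSet) : Set H.vertexSet),
      ncard_image_val H _, ?_, ?_⟩
    · rintro _ ⟨v, -, rfl⟩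
      exact v.2
    · rintro e ⟨heT, he⟩
      rcases he with he | he
      · obtain ⟨a, rfl⟩ := Set.ncard_eq_one.1 he
        obtain ⟨v, hv, hva⟩ := heT rfl
        rw [← hva]
        exact H.mem_loopVertices.1 (Finset.mem_inter.1 (Finset.mem_coe.1 hv)).1
      · refine (hSE ⟨heT.trans (Set.image_mono ?_), he⟩).1
        exact Finset.coe_subset.2 Finset.inter_subset_right
  obtain ⟨P, hLP, hPS, hPt⟩ := Finset.exists_subsuperset_card_eq
    (Finset.inter_subset_right (s₁ := H.loopVertices) (s₂ := S)) hLS (hS₀ ▸ hts)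
  obtain ⟨hx0, -, hx1⟩ := hx
  rw [finsum_vertexSet_eq] at hx1
  have hmem : (fun v : H.vertexSet => x v.1) ∈ stdSimplex ℝ H.vertexSet := ⟨fun v => hx0 v, hx1⟩
  have h1 := cubicForm_le_add_sum_sdiff hE ht hSE'
    (by rw [hS₀, card_tripleFamily]; exact hupper) _ P _ hPS hPt hmem le_rfl
  have hdisj : Disjoint H.loopVertices (S \ P) := by
    rw [Finset.disjoint_left]
    intro v hv hvS
    obtain ⟨hvS, hvP⟩ := Finset.mem_sdiff.1 hvS
    exact hvP (hLP (Finset.mem_inter.2 ⟨hv, hvS⟩))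
  have h2 : ∑ v ∈ H.loopVertices, x v.1 + ∑ v ∈ S \ P, x v.1 ≤ 1 := by
    rw [← Finset.sum_union hdisj, ← hx1]
    exact Finset.sum_le_sum_of_subset_of_nonneg (Finset.subset_univ _) fun v _ _ => hx0 v
  rw [lagrangianPoly_eq H hR]
  linarith

/-- The uniform weighting on a complete `{1, 3}`-subgraph of order `t`. -/
theorem exists_le_lagrangianPoly (hR : H.edgeTypes = {1, 3}) {t : ℕ} (ht : 0 < t)
    (hT : t ∈ H.completeSubgraphOrders {1, 3}) :
    ∃ x ∈ H.legalWeightings, 1 + ((t : ℝ) - 1) * (t - 2) / t ^ 2 ≤ H.lagrangianPoly x := by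
  classical
  obtain ⟨T₀, hT₀, hTV, hTE⟩ := hT
  obtain ⟨T, rfl⟩ := H.exists_finset_image_val hTV
  rw [ncard_image_val] at hT₀
  have ht0 : (t : ℝ) ≠ 0 := by exact_mod_cast ht.ne'
  have hE : ∀ e ∈ H.tripleFamily, #e = 3 := fun e he => (H.mem_tripleFamily.1 he).1
  set x : α → ℝ := fun a => if h : a ∈ H.vertexSet then charW T ⟨a, h⟩ / t else 0 with hxdef
  have hxv : ∀ v : H.vertexSet, x v.1 = charW T v / t := fun v => by simp [hxdef]
  refine ⟨x, ⟨fun a => ?_, fun a ha => by simp [hxdef, ha], ?_⟩, ?_⟩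
  · simp only [hxdef]
    split_ifs with h
    · exact div_nonneg (charW_nonneg T _) (Nat.cast_nonneg t)
    · exact le_rfl
  · rw [finsum_vertexSet_eq]
    simp only [hxv, ← Finset.sum_div, sum_charW, hT₀]
    exact div_self ht0
  · rw [lagrangianPoly_eq H hR]
    have hTL : T ⊆ H.loopVertices := by
      intro v hv
      refine H.mem_loopVertices.2 (hTE ⟨?_, Or.inl (Set.ncard_singleton _)⟩)
      rintro _ rfl
      exact ⟨v, hv, rfl⟩
    have hTT : powersetCard 3 T ⊆ H.tripleFamily := by
      intro e he
      obtain ⟨heT, he3⟩ := Finset.mem_powersetCard.1 he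
      refine H.mem_tripleFamily.2 ⟨he3, hTE ⟨Set.image_mono (Finset.coe_subset.2 heT), ?_⟩⟩
      rw [ncard_image_val, he3]
      exact Or.inr rfl
    refine add_le_add ?_ ?_
    · have h1 : ∑ v ∈ T, x v.1 = 1 := by
        simp only [hxv, ← Finset.sum_div]
        have : ∑ v ∈ T, charW T v = t := by
          rw [← hT₀, ← sum_charW T]
          refine Finset.sum_subset (Finset.subset_univ T) fun v _ hv => if_neg hv
        rw [this, div_self ht0]
      rw [← h1]
      refine Finset.sum_le_sum_of_subset_of_nonneg hTL fun v _ _ => ?_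
      rw [hxv]
      exact div_nonneg (charW_nonneg T _) (Nat.cast_nonneg t)
    · have h2 : ((t : ℝ) - 1) * (t - 2) / t ^ 2 =
          ∑ i, ∑ j, ∑ k, (if i ≠ j ∧ i ≠ k ∧ j ≠ k then
            charW T i * charW T j * charW T k else 0) * (1 / (t : ℝ) ^ 3) := by
        simp only [← Finset.sum_mul]
        rw [sum_distinct_charW, hT₀]
        field_simp
      rw [h2, cubicForm_eq_sum]
      refine Finset.sum_le_sum fun i _ => Finset.sum_le_sum fun j _ =>
        Finset.sum_le_sum fun k _ => ?_
      have h3 : x i.1 * x j.1 * x k.1 = charW T i * charW T j * charW T k * (1 / (t : ℝ) ^ 3) := by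
        rw [hxv, hxv, hxv]
        field_simp
      have hnn : 0 ≤ charW T i * charW T j * charW T k * (1 / (t : ℝ) ^ 3) :=
        mul_nonneg (mul_nonneg (mul_nonneg (charW_nonneg _ _) (charW_nonneg _ _))
          (charW_nonneg _ _)) (by positivity)
      rw [h3]
      split_ifs with h
      · by_cases hT : i ∈ T ∧ j ∈ T ∧ k ∈ T
        · rw [triInd_of_mem, one_mul]
          refine hTT (Finset.mem_powersetCard.2
            ⟨?_, Finset.card_eq_three.2 ⟨i, j, k, h.1, h.2.1, h.2.2, rfl⟩⟩)
          simp [Finset.insert_subset_iff, hT]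
        · have : charW T i * charW T j * charW T k = 0 := by
            by_cases hi : i ∈ T
            · by_cases hj : j ∈ T
              · have hk : k ∉ T := fun hk => hT ⟨hi, hj, hk⟩
                simp [charW, hk]
              · simp [charW, hj]
            · simp [charW, hi]
          rw [this]; simp
      · rw [zero_mul]
        exact mul_nonneg (triInd_nonneg _ _ _) hnn

end Transfer

theorem lagrangian_eq_of_clique {α : Type*} (H : Hypergraph α) (hV : H.vertexSet.Finite)
    (hR : H.edgeTypes = {1, 3}) {t s : ℕ} (ht : 5 ≤ t) (hts : t ≤ s)
    (hmaxt : H.MaxCompleteOrder {1, 3} t) (hs : s ∈ (H.level 3).completeSubgraphOrders {3})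
    (hupper : (H.level 3).numEdges ≤ s.choose 3 + (t - 1).choose 2) :
    H.lagrangian = 1 + ((t : ℝ) - 1) * ((t : ℝ) - 2) / (t : ℝ) ^ 2 := by
  have := hV.fintype
  have hub : ∀ y ∈ H.lagrangianPoly '' H.legalWeightings,
      y ≤ 1 + ((t : ℝ) - 1) * ((t : ℝ) - 2) / (t : ℝ) ^ 2 := by
    rintro _ ⟨x, hx, rfl⟩
    exact H.lagrangianPoly_le hR ht hts hmaxt.2 hs hupper hx
  obtain ⟨x, hx, hle⟩ := H.exists_le_lagrangianPoly hR (by omega) hmaxt.1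
  exact le_antisymm (csSup_le ⟨_, x, hx, rfl⟩ hub)
    (hle.trans (le_csSup ⟨_, hub⟩ ⟨x, hx, rfl⟩))

theorem completeK_edgeTypes {t : ℕ} (ht : 3 ≤ t) :
    (completeK t {1, 3}).edgeTypes = {1, 3} := by
  ext r
  constructor
  · rintro ⟨e, he, rfl⟩
    exact he.2
  · intro hr
    have hr3 : r ≤ (Set.Icc 1 t).ncard := by
      rw [← Finset.coe_Icc, Set.ncard_coe_finset, Nat.card_Icc]
      rcases hr with rfl | rfl <;> omega
    obtain ⟨e, he, her⟩ := Set.exists_subset_card_eq hr3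
    exact ⟨e, ⟨he, her ▸ hr⟩, her⟩

theorem ncard_Icc_one (t : ℕ) : (Set.Icc 1 t).ncard = t := by
  rw [← Finset.coe_Icc, Set.ncard_coe_finset, Nat.card_Icc, Nat.add_sub_cancel]

theorem completeK_maxCompleteOrder (t : ℕ) (R : Set ℕ) :
    (completeK t R).MaxCompleteOrder R t := by
  refine ⟨⟨Set.Icc 1 t, ncard_Icc_one t, subset_rfl, subset_rfl⟩, ?_⟩
  rintro _ ⟨S, rfl, hS, -⟩
  exact (Set.ncard_le_ncard hS (Set.finite_Icc 1 t)).trans (ncard_Icc_one t).le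

theorem completeK_level_three_numEdges (t : ℕ) :
    ((completeK t {1, 3}).level 3).numEdges ≤ t.choose 3 := by
  have h : ((completeK t {1, 3}).level 3).edgeSet ⊆
      (fun e : Finset ℕ => (e : Set ℕ)) '' (powersetCard 3 (Finset.Icc 1 t)) := by
    rintro e ⟨⟨he, -⟩, h3⟩
    have hfin : e.Finite := (Set.finite_Icc 1 t).subset he
    refine ⟨hfin.toFinset, ?_, hfin.coe_toFinset⟩
    rw [Finset.mem_coe, Finset.mem_powersetCard, ← Set.ncard_eq_toFinset_card e hfin]
    refine ⟨fun i hi => Finset.mem_Icc.2 (he (hfin.mem_toFinset.1 hi)), h3⟩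
  refine (Set.ncard_le_ncard h (Set.toFinite _)).trans ?_
  rw [Set.ncard_image_of_injective _ Finset.coe_injective, Set.ncard_coe_finset,
    Finset.card_powersetCard, Nat.card_Icc, Nat.add_sub_cancel]

end Hypergraph

theorem theorem1p6 {α : Type*} (H : Hypergraph α) (hV : H.vertexSet.Finite)
    (hR : H.edgeTypes = {1, 3}) (t s : ℕ) (ht : 5 ≤ t) (hts : t ≤ s)
    (hmaxt : H.MaxCompleteOrder {1, 3} t)
    (hmaxs : (H.level 3).MaxCompleteOrder {3} s)
    (hlower : s.choose 3 ≤ (H.level 3).numEdges)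
    (hupper : (H.level 3).numEdges ≤ s.choose 3 + (t - 1).choose 2) :
    H.lagrangian = (Hypergraph.completeK t {1, 3}).lagrangian ∧
      (Hypergraph.completeK t {1, 3}).lagrangian
        = 1 + ((t : ℝ) - 1) * ((t : ℝ) - 2) / (t : ℝ) ^ 2 := by
  have hK : (Hypergraph.completeK t {1, 3}).lagrangian =
      1 + ((t : ℝ) - 1) * ((t : ℝ) - 2) / (t : ℝ) ^ 2 := by
    refine (Hypergraph.completeK t {1, 3}).lagrangian_eq_of_clique (Set.finite_Icc 1 t)
      (Hypergraph.completeK_edgeTypes (by omega)) ht le_rfl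
      (Hypergraph.completeK_maxCompleteOrder t _) ?_
      ((Hypergraph.completeK_level_three_numEdges t).trans (Nat.le_add_right _ _))
    refine ⟨Set.Icc 1 t, Hypergraph.ncard_Icc_one t, subset_rfl, ?_⟩
    rintro e ⟨he, h3⟩
    exact ⟨⟨he, Or.inr h3⟩, h3⟩
  exact ⟨(H.lagrangian_eq_of_clique hV hR ht hts hmaxt hmaxs.1 hupper).trans hK.symm, hK⟩
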